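/- Let $n\ge 1$ and let $X$ be a standard Gaussian random variable. Consider real trigonometric polynomials of degree at most $n$, $$f(x)=\sum_{k=0}^n(a_k\cos kx+b_k\sin kx),\qquad g(x)=\sum_{k=0}^n(c_k\cos kx+d_k\sin kx).$$ Write $P_Y$ for the law of a random variable $Y$ and $\|\cdot\|_{var}$ for the total variation norm of a signed measure, $\|\mu\|_{var}=\sup\sum_i|\mu(A_i)|$ over finite measurable partitions. (1) For every $m$, one has $f^{(l)}(0)=0$ for all $1\le l\le 2m$ if and only if $$\sum_{k=1}^n k^{2i-1}b_k=0\quad\text{and}\quad \sum_{k=1}^n k^{2i}a_k=0\qquad(i=1,\dots,m).$$ For $m=n$ the determinant $\Delta$ of this linear system of $2n$ equations, with the unknowns ordered as $(b_1,\dots,b_n,a_1,\dots,a_n)$ and the equations for the $b_k$ listed first, is $$\Delta=(n!)^3\,W(1,2^2,\dots,n^2)^2\neq 0,$$ where $W$ is the Vandermonde determinant. (2) If $f$ is non-constant, then at no point $x$ do more than $2n-1$ consecutive derivatives, starting with the first, vanish: if $f^{(l)}(x)=0$ for all $1\le l\le m$, then $m\le 2n-1$. (3) If $f$ is non-constant,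 then there is a constant $C_f$ such that $$\|P_{f(X)}-P_{f(X)+u}\|_{var}\le C_f|u|^{1/(2n)}\qquad\text{for all }u\in\mathbb R.$$ (4) Let $f$ and $g$ be non-constant, put $\alpha=1/(2n)$, and let $C_f$ and $C_g$ be any constants with which the inequality in (3) holds for $f$ and for $g$ respectively. Then $$\|P_{f(X)}-P_{g(X)}\|_{var}\le C\,\|f-g\|_\infty^{1/(2n+1)},\qquad C=(C_f+C_g)^{\frac1{\alpha+1}}\Bigl(E|\nu|^\alpha+\sqrt{\pi/2}\Bigr),$$ where $\nu$ is standard Gaussian and $\|f-g\|_\infty=\sup_{x\in\mathbb R}|f(x)-g(x)|$. -/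

import Mathlib

namespace TrigGauss

/-- The trigonometric polynomial `∑_{k=0}^n (a_k cos kx + b_k sin kx)`. -/
noncomputable def trigPoly (n : ℕ) (a b : ℕ → ℝ) (x : ℝ) : ℝ :=
  ∑ k ∈ Finset.range (n + 1), (a k * Real.cos (k * x) + b k * Real.sin (k * x))

/-- `f` is not a constant function. -/
def NonConst (f : ℝ → ℝ) : Prop := ¬ ∃ c : ℝ, ∀ x : ℝ, f x = c

/-- The matrix of the linear system
`∑_{k=1}^n k^(2i-1) b_k = 0`, `∑_{k=1}^n k^(2i) a_k = 0` (`i = 1, …, m`)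
in the unknowns `(b_1, …, b_n, a_1, …, a_n)`. Indices in `Fin` start at `0`. -/
def derivSystem (m n : ℕ) : Matrix (Fin m ⊕ Fin m) (Fin n ⊕ Fin n) ℝ :=
  Matrix.fromBlocks
    (Matrix.of fun i k => (((k : ℕ) : ℝ) + 1) ^ (2 * (i : ℕ) + 1)) 0
    0 (Matrix.of fun i k => (((k : ℕ) : ℝ) + 1) ^ (2 * (i : ℕ) + 2))

/-- The Vandermonde determinant `W(1, 2², …, n²)`. -/
noncomputable def vandermondeSq (n : ℕ) : ℝ :=
  (Matrix.vandermonde fun k : Fin n => (((k : ℕ) : ℝ) + 1) ^ 2).det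

/-- `‖P - Q‖_var`: the total mass of the variation of the signed measure `P - Q`
(so it is at most `2` for probability measures). -/
noncomputable def varDist (P Q : MeasureTheory.Measure ℝ)
    [MeasureTheory.IsFiniteMeasure P] [MeasureTheory.IsFiniteMeasure Q] : ℝ :=
  (P.toSignedMeasure - Q.toSignedMeasure).totalVariation.real Set.univ

/-- `‖P_Y - P_{Y+u}‖_var ≤ C |u|^α` for all real `u`. -/
def ShiftBound {Ω : Type*} [MeasurableSpace Ω] (μ : MeasureTheory.Measure Ω)
    [MeasureTheory.IsFiniteMeasure μ] (Y : Ω → ℝ) (α C : ℝ) : Prop :=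
  ∀ u : ℝ, varDist (μ.map Y) (μ.map fun ω => Y ω + u) ≤ C * |u| ^ α

/-- `‖f - g‖_∞ = sup_x |f x - g x|` (used for bounded functions only). -/
noncomputable def supDist (f g : ℝ → ℝ) : ℝ := ⨆ x : ℝ, |f x - g x|

/-- `(C_f + C_g)^(1/(α+1)) (E|ν|^α + √(π/2))` with `ν` standard Gaussian. -/
noncomputable def boundConst (α Cf Cg : ℝ) : ℝ :=
  (Cf + Cg) ^ (1 / (α + 1)) *
    ((∫ t, |t| ^ α ∂(ProbabilityTheory.gaussianReal 0 1)) + Real.sqrt (Real.pi / 2))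

end TrigGauss

/-! ### Derivatives at a point, the linear system and its determinant. -/

namespace TrigGauss

open Finset

/-! Parts (1) and (2) are linear algebra. The system is block diagonal, each block being a
Vandermonde matrix in the nodes `k²` with rescaled columns. Hence `2n` vanishing derivatives at a
point force constancy, after translating the point to the origin.

For (3), total variation is tested on continuous `h` with `|h| ≤ 1`, so `E[h(f(X)+u) - h(f(X))]`
must be bounded. With `F = f'`, write `1 = F · F/(F²+δ²) + δ²/(F²+δ²)`. In the first term `(h(f+u) -
h(f)) f'` is the derivative of a function bounded by `|u|`; integration by parts leaves `|u|` times
an integral of order `1/δ`, because `F'/(F²+δ²)` is the derivative of an arctangent. The second term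
has order `δ^(1/(2n-1))`, because by (2) the zeros of `F` have order at most `2n-1`. Both bounds are
local; compactness, periodicity and Gaussian decay make them global. Choosing `δ =
|u|^((2n-1)/(2n))` balances them (`exists_integral_increment_trigPoly_le`).

For (4), independent Gaussian noise `εν` is added to `f(X)` and `g(X)`. By the shift bounds this
costs `(C_f + C_g) ε^α E|ν|^α`, while the smoothed laws differ by at most `‖f-g‖_∞/ε`. It remains to
optimize `ε`. -/

theorem hasDerivAt_trigPoly (n : ℕ) (a b : ℕ → ℝ) (x : ℝ) :
    HasDerivAt (trigPoly n a b) (trigPoly n (fun k => k * b k) (fun k => -(k * a k)) x) x := by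
  unfold trigPoly
  refine HasDerivAt.fun_sum fun k _ => ?_
  have h : HasDerivAt (fun y : ℝ => (k : ℝ) * y) k x := by
    simpa using (hasDerivAt_id x).const_mul (k : ℝ)
  refine ((h.cos.const_mul (a k)).add (h.sin.const_mul (b k))).congr_deriv ?_
  ring

theorem deriv_trigPoly (n : ℕ) (a b : ℕ → ℝ) :
    deriv (trigPoly n a b) = trigPoly n (fun k => k * b k) (fun k => -(k * a k)) :=
  funext fun x => (hasDerivAt_trigPoly n a b x).deriv

theorem iteratedDeriv_even_trigPoly (n : ℕ) (a b : ℕ → ℝ) (j : ℕ) :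
    iteratedDeriv (2 * j) (trigPoly n a b)
      = trigPoly n (fun k => (-1) ^ j * (k : ℝ) ^ (2 * j) * a k)
          (fun k => (-1) ^ j * (k : ℝ) ^ (2 * j) * b k) := by
  induction j with
  | zero => simp
  | succ j ih =>
    rw [mul_add, mul_one, iteratedDeriv_succ, iteratedDeriv_succ, ih, deriv_trigPoly,
      deriv_trigPoly]
    congr 1 <;> funext k <;> ring

theorem iteratedDeriv_odd_trigPoly (n : ℕ) (a b : ℕ → ℝ) (j : ℕ) :
    iteratedDeriv (2 * j + 1) (trigPoly n a b)
      = trigPoly n (fun k => (-1) ^ j * (k : ℝ) ^ (2 * j + 1) * b k)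
          (fun k => -((-1) ^ j * (k : ℝ) ^ (2 * j + 1) * a k)) := by
  rw [iteratedDeriv_succ, iteratedDeriv_even_trigPoly, deriv_trigPoly]
  congr 1 <;> funext k <;> ring

theorem trigPoly_zero (n : ℕ) (a b : ℕ → ℝ) :
    trigPoly n a b 0 = ∑ k ∈ range (n + 1), a k := by
  simp [trigPoly]

theorem iteratedDeriv_even_trigPoly_zero (n : ℕ) (a b : ℕ → ℝ) (i : ℕ) :
    iteratedDeriv (2 * i + 2) (trigPoly n a b) 0
      = (-1) ^ (i + 1) * ∑ k : Fin n, (((k : ℕ) : ℝ) + 1) ^ (2 * i + 2) * a (k + 1) := by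
  rw [← mul_add_one 2 i, iteratedDeriv_even_trigPoly, trigPoly_zero, sum_range_succ', mul_sum,
    Fin.sum_univ_eq_sum_range
      (fun k => (-1 : ℝ) ^ (i + 1) * (((k : ℝ) + 1) ^ (2 * (i + 1)) * a (k + 1)))]
  simp [mul_assoc]

theorem iteratedDeriv_odd_trigPoly_zero (n : ℕ) (a b : ℕ → ℝ) (i : ℕ) :
    iteratedDeriv (2 * i + 1) (trigPoly n a b) 0
      = (-1) ^ i * ∑ k : Fin n, (((k : ℕ) : ℝ) + 1) ^ (2 * i + 1) * b (k + 1) := by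
  rw [iteratedDeriv_odd_trigPoly, trigPoly_zero, sum_range_succ', mul_sum,
    Fin.sum_univ_eq_sum_range
      (fun k => (-1 : ℝ) ^ i * (((k : ℝ) + 1) ^ (2 * i + 1) * b (k + 1)))]
  simp [mul_assoc]

theorem derivSystem_mulVec_eq_zero_iff (m n : ℕ) (v w : Fin n → ℝ) :
    (derivSystem m n).mulVec (Sum.elim v w) = 0 ↔
      (∀ i : Fin m, ∑ k : Fin n, (((k : ℕ) : ℝ) + 1) ^ (2 * (i : ℕ) + 1) * v k = 0) ∧
      ∀ i : Fin m, ∑ k : Fin n, (((k : ℕ) : ℝ) + 1) ^ (2 * (i : ℕ) + 2) * w k = 0 := by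
  rw [funext_iff, Sum.forall]
  simp [derivSystem, Matrix.mulVec, dotProduct, Fintype.sum_sum_type]

theorem iteratedDeriv_trigPoly_zero_iff (m n : ℕ) (a b : ℕ → ℝ) :
    (∀ l ∈ Icc 1 (2 * m), iteratedDeriv l (trigPoly n a b) 0 = 0) ↔
      (derivSystem m n).mulVec
        (Sum.elim (fun k : Fin n => b (k + 1)) (fun k : Fin n => a (k + 1))) = 0 := by
  rw [derivSystem_mulVec_eq_zero_iff]
  constructor
  · intro h
    refine ⟨fun i => ?_, fun i => ?_⟩
    · have := h (2 * i + 1) (mem_Icc.2 (by omega))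
      rw [iteratedDeriv_odd_trigPoly_zero] at this
      simpa using this
    · have := h (2 * i + 2) (mem_Icc.2 (by omega))
      rw [iteratedDeriv_even_trigPoly_zero] at this
      simpa using this
  · rintro ⟨h₁, h₂⟩ l hl
    rw [mem_Icc] at hl
    obtain ⟨i, rfl | rfl⟩ : ∃ i, l = 2 * i + 1 ∨ l = 2 * i + 2 := ⟨(l - 1) / 2, by omega⟩
    · rw [iteratedDeriv_odd_trigPoly_zero, h₁ ⟨i, by omega⟩, mul_zero]
    · rw [iteratedDeriv_even_trigPoly_zero, h₂ ⟨i, by omega⟩, mul_zero]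

theorem prod_fin_add_one (n : ℕ) : ∏ k : Fin n, (((k : ℕ) : ℝ) + 1) = n.factorial := by
  rw [Fin.prod_univ_eq_prod_range (fun k => (k : ℝ) + 1), ← prod_range_add_one_eq_factorial]
  push_cast
  rfl

/-- Column `k` contributes a factor `k` in the first block and `k²` in the second, hence `n!` and
`(n!)²`; what remains in each block is a transposed Vandermonde matrix. -/
theorem det_derivSystem (n : ℕ) :
    (derivSystem n n).det = (n.factorial : ℝ) ^ 3 * vandermondeSq n ^ 2 := by
  let V := (Matrix.vandermonde fun k : Fin n => (((k : ℕ) : ℝ) + 1) ^ 2).transpose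
  have hV : V.det = vandermondeSq n := Matrix.det_transpose _
  have h₁ : (Matrix.of fun i k : Fin n => (((k : ℕ) : ℝ) + 1) ^ (2 * (i : ℕ) + 1))
      = Matrix.of fun i k : Fin n => (((k : ℕ) : ℝ) + 1) * V i k := by
    ext i k
    simp only [Matrix.of_apply, V, Matrix.transpose_apply, Matrix.vandermonde_apply, ← pow_mul]
    ring
  have h₂ : (Matrix.of fun i k : Fin n => (((k : ℕ) : ℝ) + 1) ^ (2 * (i : ℕ) + 2))
      = Matrix.of fun i k : Fin n => (((k : ℕ) : ℝ) + 1) ^ 2 * V i k := by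
    ext i k
    simp only [Matrix.of_apply, V, Matrix.transpose_apply, Matrix.vandermonde_apply, ← pow_mul]
    ring
  rw [derivSystem, Matrix.det_fromBlocks_zero₂₁, h₁, h₂, Matrix.det_mul_row, Matrix.det_mul_row,
    hV, prod_pow, prod_fin_add_one]
  ring

theorem det_derivSystem_ne_zero (n : ℕ) : (derivSystem n n).det ≠ 0 := by
  rw [det_derivSystem]
  refine mul_ne_zero (pow_ne_zero _ (by exact_mod_cast n.factorial_ne_zero)) (pow_ne_zero _ ?_)
  rw [vandermondeSq, Matrix.det_vandermonde_ne_zero_iff]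
  intro i j hij
  have : ((i : ℕ) : ℝ) + 1 = (j : ℕ) + 1 :=
    (pow_left_inj₀ (by positivity) (by positivity) two_ne_zero).1 hij
  exact Fin.ext (by exact_mod_cast add_right_cancel this)

/-- Translation preserves the degree bound, so derivatives at any point become derivatives at the
origin. -/
theorem trigPoly_add (n : ℕ) (a b : ℕ → ℝ) (x y : ℝ) :
    trigPoly n a b (x + y)
      = trigPoly n (fun k => a k * Real.cos (k * x) + b k * Real.sin (k * x))
          (fun k => b k * Real.cos (k * x) - a k * Real.sin (k * x)) y := by
  refine sum_congr rfl fun k _ => ?_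
  rw [mul_add, Real.cos_add, Real.sin_add]
  ring

theorem trigPoly_add_two_pi (n : ℕ) (a b : ℕ → ℝ) :
    Function.Periodic (trigPoly n a b) (2 * Real.pi) := by
  intro x
  refine sum_congr rfl fun k _ => ?_
  rw [mul_add, Real.cos_add_nat_mul_two_pi, Real.sin_add_nat_mul_two_pi]

theorem abs_trigPoly_le (n : ℕ) (a b : ℕ → ℝ) (x : ℝ) :
    |trigPoly n a b x| ≤ ∑ k ∈ range (n + 1), (|a k| + |b k|) := by
  refine (abs_sum_le_sum_abs _ _).trans (sum_le_sum fun k _ => (abs_add_le _ _).trans ?_)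
  rw [abs_mul, abs_mul]
  exact add_le_add (mul_le_of_le_one_right (abs_nonneg _) (Real.abs_cos_le_one _))
    (mul_le_of_le_one_right (abs_nonneg _) (Real.abs_sin_le_one _))

theorem le_of_iteratedDeriv_trigPoly_eq_zero {n : ℕ} (hn : 1 ≤ n) {a b : ℕ → ℝ}
    (hf : NonConst (trigPoly n a b)) (x : ℝ) (m : ℕ)
    (h : ∀ l ∈ Icc 1 m, iteratedDeriv l (trigPoly n a b) x = 0) : m ≤ 2 * n - 1 := by
  by_contra! hm
  refine hf ?_
  set a' : ℕ → ℝ := fun k => a k * Real.cos (k * x) + b k * Real.sin (k * x)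
  set b' : ℕ → ℝ := fun k => b k * Real.cos (k * x) - a k * Real.sin (k * x)
  have hfun : trigPoly n a' b' = fun y => trigPoly n a b (x + y) :=
    funext fun y => (trigPoly_add n a b x y).symm
  have h0 := (iteratedDeriv_trigPoly_zero_iff n n a' b').1 fun l hl => by
    rw [hfun, iteratedDeriv_comp_const_add]
    simpa using h l (mem_Icc.2 (by rw [mem_Icc] at hl; omega))
  -- Invertibility kills every translated coefficient with `k ≥ 1`; only the constant term `a' 0`
  -- survives.
  have hz := Matrix.eq_zero_of_mulVec_eq_zero (det_derivSystem_ne_zero n) h0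
  refine ⟨a' 0, fun y => ?_⟩
  have hy : trigPoly n a b y = trigPoly n a' b' (y - x) := by
    rw [hfun]
    simp
  rw [hy, trigPoly, sum_range_succ', sum_eq_zero]
  · simp
  · intro k hk
    have h₁ := congrFun hz (Sum.inl ⟨k, mem_range.1 hk⟩)
    have h₂ := congrFun hz (Sum.inr ⟨k, mem_range.1 hk⟩)
    simp only [Sum.elim_inl, Sum.elim_inr, Pi.zero_apply] at h₁ h₂
    rw [h₁, h₂]
    ring

end TrigGauss

/-! ### Total variation through test functions. -/

namespace TrigGauss

open MeasureTheory

section VarDist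

variable (P Q : Measure ℝ) [IsFiniteMeasure P] [IsFiniteMeasure Q]

theorem varDist_eq_add :
    varDist P Q
      = (P.toSignedMeasure - Q.toSignedMeasure).toJordanDecomposition.posPart.real Set.univ
      + (P.toSignedMeasure - Q.toSignedMeasure).toJordanDecomposition.negPart.real Set.univ := by
  rw [varDist, SignedMeasure.totalVariation, measureReal_add_apply]

theorem varDist_nonneg : 0 ≤ varDist P Q := measureReal_nonneg

/-- The Jordan decomposition with the subtractions cleared: an identity of measures, against which
functions can be integrated. -/
theorem add_negPart_eq_add_posPart :
    P + (P.toSignedMeasure - Q.toSignedMeasure).toJordanDecomposition.negPart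
      = Q + (P.toSignedMeasure - Q.toSignedMeasure).toJordanDecomposition.posPart := by
  have h := SignedMeasure.toSignedMeasure_toJordanDecomposition
    (P.toSignedMeasure - Q.toSignedMeasure)
  rw [JordanDecomposition.toSignedMeasure] at h
  rw [← Measure.toSignedMeasure_eq_toSignedMeasure_iff, Measure.toSignedMeasure_add,
    Measure.toSignedMeasure_add, add_comm Q.toSignedMeasure]
  exact (sub_eq_sub_iff_add_eq_add.1 h).symm

/-- Integrals of functions bounded by `1` differ by at most the variation distance. -/
theorem integral_sub_integral_le_varDist {h : ℝ → ℝ} (hm : Measurable h) (hb : ∀ x, |h x| ≤ 1) :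
    ∫ x, h x ∂P - ∫ x, h x ∂Q ≤ varDist P Q := by
  have hi : ∀ (ρ : Measure ℝ) [IsFiniteMeasure ρ], Integrable h ρ := fun ρ _ =>
    Integrable.of_bound hm.aestronglyMeasurable 1 (Filter.Eventually.of_forall hb)
  have hle : ∀ (ρ : Measure ℝ) [IsFiniteMeasure ρ], |(∫ x, h x ∂ρ)| ≤ ρ.real Set.univ := by
    intro ρ _
    simpa using norm_integral_le_of_norm_le_const (μ := ρ) (f := h) (C := 1)
      (Filter.Eventually.of_forall hb)
  set J := (P.toSignedMeasure - Q.toSignedMeasure).toJordanDecomposition with hJ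
  have hsum := congrArg (fun ρ : Measure ℝ => ∫ x, h x ∂ρ) (add_negPart_eq_add_posPart P Q)
  simp only [← hJ] at hsum
  rw [integral_add_measure (hi _) (hi _), integral_add_measure (hi _) (hi _)] at hsum
  rw [varDist_eq_add, ← hJ]
  have h₁ := le_abs_self (∫ x, h x ∂J.posPart)
  have h₂ := neg_abs_le (∫ x, h x ∂J.negPart)
  linarith [hle J.posPart, hle J.negPart]

theorem exists_varDist_eq :
    ∃ S, MeasurableSet S ∧ varDist P Q = (P.real S - Q.real S) - (P.real Sᶜ - Q.real Sᶜ) := by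
  set J := (P.toSignedMeasure - Q.toSignedMeasure).toJordanDecomposition with hJ
  obtain ⟨S, hS, hpos, hneg⟩ := J.mutuallySingular
  have hreal : ∀ A, MeasurableSet A →
      P.real A + J.negPart.real A = Q.real A + J.posPart.real A := by
    intro A _
    have := congrArg (fun ρ : Measure ℝ => ρ.real A) (add_negPart_eq_add_posPart P Q)
    simp only [← hJ] at this
    rwa [measureReal_add_apply, measureReal_add_apply] at this
  -- `S` is null for the positive part, so the Hahn positive set is its complement.
  refine ⟨Sᶜ, hS.compl, ?_⟩
  have h₁ := hreal S hS
  have h₂ := hreal Sᶜ hS.compl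
  have hp : J.posPart.real S = 0 := by simp [Measure.real, hpos]
  have hn : J.negPart.real Sᶜ = 0 := by simp [Measure.real, hneg]
  have hp' := measureReal_add_measureReal_compl (μ := J.posPart) hS
  have hn' := measureReal_add_measureReal_compl (μ := J.negPart) hS
  rw [varDist_eq_add, ← hJ, compl_compl]
  linarith

/-- It suffices to bound the variation distance on continuous test functions. -/
theorem varDist_le_of_continuous {C : ℝ}
    (hC : ∀ h : ℝ → ℝ, Continuous h → (∀ x, |h x| ≤ 1) → ∫ x, h x ∂P - ∫ x, h x ∂Q ≤ C) :
    varDist P Q ≤ C := by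
  obtain ⟨S, hS, hv⟩ := exists_varDist_eq P Q
  refine le_of_forall_pos_le_add fun ε hε => ?_
  set h₀ : ℝ → ℝ := fun x => S.indicator (fun _ => 1) x - Sᶜ.indicator (fun _ => 1) x with hh₀
  have hm₀ : Measurable h₀ :=
    (measurable_const.indicator hS).sub (measurable_const.indicator hS.compl)
  have hb₀ : ∀ x, |h₀ x| ≤ 1 := by
    intro x
    by_cases hx : x ∈ S <;> simp [hh₀, hx]
  have hi₀ : ∀ (ρ : Measure ℝ) [IsFiniteMeasure ρ], Integrable h₀ ρ := fun ρ _ =>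
    Integrable.of_bound hm₀.aestronglyMeasurable 1 (Filter.Eventually.of_forall hb₀)
  have hI₀ : ∀ (ρ : Measure ℝ) [IsFiniteMeasure ρ],
      ∫ x, h₀ x ∂ρ = ρ.real S - ρ.real Sᶜ := by
    intro ρ _
    rw [hh₀, integral_sub ((integrable_const (1 : ℝ)).indicator hS)
        ((integrable_const (1 : ℝ)).indicator hS.compl),
      integral_indicator_const _ hS, integral_indicator_const _ hS.compl]
    simp
  -- Approximating in `L¹(P + Q)` yields one continuous `g` that serves both measures. Truncating it
  -- to `[-1, 1]` does no harm, since `h₀` already takes values there.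
  obtain ⟨g, hg, -⟩ := (hi₀ (P + Q)).exists_boundedContinuous_integral_sub_le hε
  set h : ℝ → ℝ := fun x => max (-1) (min 1 (g x)) with hh
  have hc : Continuous h := continuous_const.max (continuous_const.min g.continuous)
  have hb : ∀ x, |h x| ≤ 1 := fun x =>
    abs_le.2 ⟨le_max_left _ _, max_le (by norm_num) (min_le_left _ _)⟩
  have hi : ∀ (ρ : Measure ℝ) [IsFiniteMeasure ρ], Integrable h ρ := fun ρ _ =>
    Integrable.of_bound hc.aestronglyMeasurable 1 (Filter.Eventually.of_forall hb)
  have hgi : ∀ (ρ : Measure ℝ) [IsFiniteMeasure ρ], Integrable (fun x => ‖h₀ x - g x‖) ρ :=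
    fun ρ _ => ((hi₀ ρ).sub (g.integrable ρ)).norm
  have hclose : ∀ x, ‖h₀ x - h x‖ ≤ ‖h₀ x - g x‖ := by
    intro x
    have hx := abs_le.1 (hb₀ x)
    have e : h₀ x = max (-1) (min 1 (h₀ x)) := by
      rw [min_eq_right hx.2, max_eq_right hx.1]
    rw [Real.norm_eq_abs, Real.norm_eq_abs]
    calc |h₀ x - h x| = |max (-1) (min 1 (h₀ x)) - max (-1) (min 1 (g x))| := by rw [← e]
      _ ≤ |min 1 (h₀ x) - min 1 (g x)| := by
        rw [max_comm (-1 : ℝ), max_comm (-1 : ℝ)]; exact abs_max_sub_max_le_abs _ _ _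
      _ ≤ |h₀ x - g x| := by
        rw [min_comm (1 : ℝ), min_comm (1 : ℝ)]
        refine (abs_min_sub_min_le_max _ _ _ _).trans ?_
        simp
  have hdiff : ∀ (ρ : Measure ℝ) [IsFiniteMeasure ρ],
      |(∫ x, h₀ x ∂ρ) - ∫ x, h x ∂ρ| ≤ ∫ x, ‖h₀ x - g x‖ ∂ρ := by
    intro ρ _
    rw [← integral_sub (hi₀ ρ) (hi ρ)]
    exact (norm_integral_le_integral_norm _).trans
      (integral_mono ((hi₀ ρ).sub (hi ρ)).norm (hgi ρ) hclose)
  rw [integral_add_measure (hgi P) (hgi Q)] at hg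
  have hP := abs_le.1 (hdiff P)
  have hQ := abs_le.1 (hdiff Q)
  rw [hI₀ P] at hP
  rw [hI₀ Q] at hQ
  rw [hv]
  linarith [hC h hc hb, hP.2, hQ.1]

end VarDist

end TrigGauss

/-! ### Local estimates of the two singular integrals, and their transfer to the Gaussian weight. -/

namespace TrigGauss

open MeasureTheory Filter Topology Set

section Integrals

variable {F F' : ℝ → ℝ}

theorem hasDerivAt_arctan_div (hF : ∀ x, HasDerivAt F (F' x) x) {δ : ℝ} (hδ : 0 < δ) (x : ℝ) :
    HasDerivAt (fun y => Real.arctan (F y / δ) / δ) (F' x / (F x ^ 2 + δ ^ 2)) x := by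
  refine ((((hF x).div_const δ).arctan).div_const δ).congr_deriv ?_
  have : 0 < F x ^ 2 + δ ^ 2 := by positivity
  have : 0 < 1 + (F x / δ) ^ 2 := by positivity
  field_simp
  ring

/-- For monotone `F` the integral is an increment of `arctan (F/δ)/δ`, whose range has length `π/δ`
whatever the interval. -/
theorem lintegral_Ioo_deriv_div_le_of_nonneg (hF : ∀ x, HasDerivAt F (F' x) x)
    (hc : Continuous F') {δ p q : ℝ} (hδ : 0 < δ) (h : ∀ x ∈ Ioo p q, 0 ≤ F' x) :
    ∫⁻ x in Ioo p q, ENNReal.ofReal (|F' x| / (F x ^ 2 + δ ^ 2)) ≤ ENNReal.ofReal (Real.pi / δ) := by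
  rcases le_or_gt q p with hpq | hpq
  · simp [Ioo_eq_empty_of_le hpq]
  have hFc : Continuous F := continuous_iff_continuousAt.2 fun x => (hF x).continuousAt
  have hcont : Continuous fun x => F' x / (F x ^ 2 + δ ^ 2) :=
    hc.div (by fun_prop) fun x => by positivity
  have hFTC := intervalIntegral.integral_eq_sub_of_hasDerivAt (a := p) (b := q)
    (fun x _ => hasDerivAt_arctan_div hF hδ x) (hcont.intervalIntegrable p q)
  rw [intervalIntegral.integral_of_le hpq.le, integral_Ioc_eq_integral_Ioo] at hFTC
  have hint : IntegrableOn (fun x => F' x / (F x ^ 2 + δ ^ 2)) (Ioo p q) :=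
    (hcont.integrableOn_Icc (a := p) (b := q)).mono_set Ioo_subset_Icc_self
  calc ∫⁻ x in Ioo p q, ENNReal.ofReal (|F' x| / (F x ^ 2 + δ ^ 2))
      = ∫⁻ x in Ioo p q, ENNReal.ofReal (F' x / (F x ^ 2 + δ ^ 2)) :=
        setLIntegral_congr_fun measurableSet_Ioo fun x hx => by
          simp only [abs_of_nonneg (h x hx)]
    _ = ENNReal.ofReal (∫ x in Ioo p q, F' x / (F x ^ 2 + δ ^ 2)) := by
        refine (ofReal_integral_eq_lintegral_ofReal hint ?_).symm
        filter_upwards [ae_restrict_mem measurableSet_Ioo] with x hx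
        exact div_nonneg (h x hx) (by positivity)
    _ ≤ _ := by
        rw [hFTC]
        refine ENNReal.ofReal_le_ofReal ?_
        rw [← sub_div]
        refine div_le_div_of_nonneg_right ?_ hδ.le
        linarith [Real.arctan_lt_pi_div_two (F q / δ), Real.neg_pi_div_two_lt_arctan (F p / δ)]

/-- By Darboux's theorem `F'` has constant sign; the negative case is reduced to `-F`. -/
theorem lintegral_Ioo_deriv_div_le_of_ne_zero (hF : ∀ x, HasDerivAt F (F' x) x)
    {F'' : ℝ → ℝ} (hF' : ∀ x, HasDerivAt F' (F'' x) x)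
    {δ p q : ℝ} (hδ : 0 < δ) (h : ∀ x ∈ Ioo p q, F' x ≠ 0) :
    ∫⁻ x in Ioo p q, ENNReal.ofReal (|F' x| / (F x ^ 2 + δ ^ 2)) ≤ ENNReal.ofReal (Real.pi / δ) := by
  have hc : Continuous F' := continuous_iff_continuousAt.2 fun x => (hF' x).continuousAt
  rcases hasDerivWithinAt_forall_lt_or_forall_gt_of_forall_ne (convex_Ioo p q)
    (fun x _ => (hF x).hasDerivWithinAt) h with h | h
  · have := lintegral_Ioo_deriv_div_le_of_nonneg (F := fun x => -F x) (F' := fun x => -F' x)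
      (fun x => (hF x).neg) hc.neg hδ (p := p) (q := q) fun x hx => by
        simpa using (h x hx).le
    simpa using this
  · exact lintegral_Ioo_deriv_div_le_of_nonneg hF hc hδ fun x hx => (h x hx).le

/-- Near every point, `∫ |F'| / (F² + δ²)` is of order at most `1 / δ` for analytic `F`. -/
theorem exists_nhds_lintegral_deriv_div_le (hF : ∀ x, HasDerivAt F (F' x) x)
    {F'' : ℝ → ℝ} (hF' : ∀ x, HasDerivAt F' (F'' x) x) {x₀ : ℝ} (ha : AnalyticAt ℝ F' x₀) :
    ∃ t ∈ 𝓝 x₀, ∀ δ : ℝ, 0 < δ →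
      ∫⁻ x in t, ENNReal.ofReal (|F' x| / (F x ^ 2 + δ ^ 2))
        ≤ ENNReal.ofReal (2 * Real.pi * (1 / δ)) := by
  -- Either the integrand vanishes near `x₀`, or `x₀` is at most an isolated zero of `F'` and splits
  -- a neighbourhood into two monotone pieces, whence the factor 2.
  rcases ha.eventually_eq_zero_or_eventually_ne_zero with h | h
  · refine ⟨{x | F' x = 0}, h, fun δ _ => ?_⟩
    have hc : Continuous F' := continuous_iff_continuousAt.2 fun x => (hF' x).continuousAt
    rw [setLIntegral_congr_fun (g := fun _ => 0)
      (measurableSet_eq_fun hc.measurable measurable_const)]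
    · simp
    · intro x hx
      simp only [mem_ofPred_eq] at hx
      simp [hx]
  · rw [eventually_nhdsWithin_iff, Metric.eventually_nhds_iff] at h
    obtain ⟨r, hr, h⟩ := h
    refine ⟨Ioo (x₀ - r) (x₀ + r), Ioo_mem_nhds (by linarith) (by linarith), fun δ hδ => ?_⟩
    have hsub : Ioo (x₀ - r) (x₀ + r) ⊆ (Ioo (x₀ - r) x₀ ∪ {x₀}) ∪ Ioo x₀ (x₀ + r) := by
      intro x hx
      rcases lt_trichotomy x x₀ with hlt | rfl | hgt
      · exact Or.inl (Or.inl ⟨hx.1, hlt⟩)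
      · exact Or.inl (Or.inr rfl)
      · exact Or.inr ⟨hgt, hx.2⟩
    have h₁ := lintegral_Ioo_deriv_div_le_of_ne_zero hF hF' hδ (p := x₀ - r) (q := x₀)
      fun x hx => h (by rw [Real.dist_eq, abs_lt]; constructor <;> linarith [hx.1, hx.2]) hx.2.ne
    have h₂ := lintegral_Ioo_deriv_div_le_of_ne_zero hF hF' hδ (p := x₀) (q := x₀ + r)
      fun x hx => h (by rw [Real.dist_eq, abs_lt]; constructor <;> linarith [hx.1, hx.2]) hx.1.ne'
    refine (lintegral_mono_set hsub).trans ((lintegral_union_le _ _ _).trans ?_)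
    refine (add_le_add_left (lintegral_union_le _ _ _) _).trans ?_
    rw [setLIntegral_measure_zero _ _ (Real.volume_singleton), add_zero]
    refine (add_le_add h₁ h₂).trans ?_
    rw [← ENNReal.ofReal_add (by positivity) (by positivity)]
    exact ENNReal.ofReal_le_ofReal (by ring_nf; rfl)

/-- Domination by a Cauchy kernel, used with `z = (x - x₀)/δ^(1/N)`. For `z² ≤ 1` the constant 2
suffices; otherwise `z² ≤ z^(2N)`, which `2/c²` absorbs. -/
theorem inv_one_add_mul_pow_le {c z : ℝ} (hc : 0 < c) {N : ℕ} (hN : 1 ≤ N) :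
    (1 + c ^ 2 * (z ^ N) ^ 2)⁻¹ ≤ (2 + 2 / c ^ 2) * (1 + z ^ 2)⁻¹ := by
  rw [← div_eq_mul_inv, le_div_iff₀ (by positivity), inv_mul_le_iff₀ (by positivity)]
  have hc2 : c ^ 2 * (2 / c ^ 2) = 2 := by field_simp
  rcases le_total (z ^ 2) 1 with h | h
  · nlinarith [show 0 ≤ 2 / c ^ 2 by positivity,
      show 0 ≤ c ^ 2 * (z ^ N) ^ 2 * (2 + 2 / c ^ 2) by positivity]
  · have h1 : z ^ 2 ≤ (z ^ N) ^ 2 := by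
      rw [← pow_mul, mul_comm, pow_mul]
      exact le_self_pow₀ h (by omega)
    have h2 : (1 + c ^ 2 * (z ^ N) ^ 2) * (2 + 2 / c ^ 2)
        = 2 + 2 / c ^ 2 + 2 * (c ^ 2 * (z ^ N) ^ 2) + c ^ 2 * (2 / c ^ 2) * (z ^ N) ^ 2 := by ring
    rw [h2, hc2]
    have : 0 ≤ c ^ 2 * (z ^ N) ^ 2 := by positivity
    have : 0 ≤ 2 / c ^ 2 := by positivity
    linarith

theorem lintegral_inv_one_add_div_sq {η : ℝ} (hη : 0 < η) {K : ℝ} (hK : 0 ≤ K) (x₀ : ℝ) :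
    ∫⁻ x, ENNReal.ofReal (K * (1 + ((x - x₀) / η) ^ 2)⁻¹) = ENNReal.ofReal (K * Real.pi * η) := by
  have hi : Integrable fun x : ℝ => K * (1 + ((x - x₀) / η) ^ 2)⁻¹ :=
    ((integrable_inv_one_add_sq.comp_div hη.ne').comp_sub_right x₀).const_mul K
  rw [← ofReal_integral_eq_lintegral_ofReal hi (Eventually.of_forall fun x => by positivity),
    integral_const_mul, integral_sub_right_eq_self (fun x : ℝ => (1 + (x / η) ^ 2)⁻¹) x₀,
    Measure.integral_comp_div (fun x : ℝ => (1 + x ^ 2)⁻¹), integral_univ_inv_one_add_sq,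
    abs_of_pos hη, smul_eq_mul]
  congr 1
  ring

/-- Near a zero of order at most `N`, `∫ δ² / (F² + δ²)` is of order at most `δ ^ (1 / N)`. -/
theorem exists_nhds_lintegral_sq_div_le {N : ℕ} (hN : 1 ≤ N) {x₀ : ℝ} (ha : AnalyticAt ℝ F x₀)
    (hord : analyticOrderAt F x₀ ≤ N) :
    ∃ t ∈ 𝓝 x₀, ∃ C : ℝ, 0 ≤ C ∧ ∀ δ : ℝ, 0 < δ →
      ∫⁻ x in t, ENNReal.ofReal (δ ^ 2 / (F x ^ 2 + δ ^ 2))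
        ≤ ENNReal.ofReal (C * δ ^ (1 / (N : ℝ))) := by
  obtain ⟨m, hm⟩ := ENat.ne_top_iff_exists.1 (ne_top_of_le_ne_top (ENat.natCast_ne_top N) hord)
  rw [← hm] at hord
  have hmN : m ≤ N := by exact_mod_cast hord
  obtain ⟨g, hg, hg0, hFg⟩ := ha.analyticOrderAt_eq_natCast.1 hm.symm
  set c := |g x₀| / 2 with hc
  have hcpos : 0 < c := by positivity
  have hgc : ∀ᶠ x in 𝓝 x₀, c < |g x| :=
    hg.continuousAt.abs.eventually (lt_mem_nhds (by rw [hc]; linarith [abs_pos.2 hg0]))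
  have hlt : ∀ᶠ x in 𝓝 x₀, |x - x₀| < 1 := by
    filter_upwards [Metric.ball_mem_nhds x₀ one_pos] with x hx
    rwa [Metric.mem_ball, Real.dist_eq] at hx
  have hlow : ∀ᶠ x in 𝓝 x₀, c ^ 2 * ((x - x₀) ^ N) ^ 2 ≤ F x ^ 2 := by
    filter_upwards [hFg, hgc, hlt] with x h₁ h₂ h₃
    rw [h₁, smul_eq_mul, mul_pow, mul_comm, ← sq_abs ((x - x₀) ^ N), ← sq_abs ((x - x₀) ^ m),
      ← sq_abs (g x), abs_pow, abs_pow]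
    -- Within distance 1 the true order `m ≤ N` may be replaced by `N`, so one exponent serves every
    -- point, including those where `F` does not vanish.
    have : |x - x₀| ^ N ≤ |x - x₀| ^ m := pow_le_pow_of_le_one (abs_nonneg _) h₃.le hmN
    gcongr
  obtain ⟨r, hr, h⟩ := Metric.eventually_nhds_iff_ball.1 hlow
  refine ⟨Metric.ball x₀ r, Metric.ball_mem_nhds _ hr, (2 + 2 / c ^ 2) * Real.pi, by positivity,
    fun δ hδ => ?_⟩
  have hη : 0 < δ ^ (1 / (N : ℝ)) := Real.rpow_pos_of_pos hδ _
  have hηN : (δ ^ (1 / (N : ℝ))) ^ N = δ := by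
    rw [one_div, Real.rpow_inv_natCast_pow hδ.le (by omega)]
  rw [← lintegral_inv_one_add_div_sq hη (by positivity) x₀]
  refine le_trans (setLIntegral_mono_ae' Metric.isOpen_ball.measurableSet ?_)
    (setLIntegral_le_lintegral (Metric.ball x₀ r) _)
  refine Eventually.of_forall fun x hx => ENNReal.ofReal_le_ofReal ?_
  refine le_trans ?_ (inv_one_add_mul_pow_le hcpos hN)
  rw [div_pow (x - x₀), hηN, div_pow (_ ^ N), ← inv_div]
  refine inv_anti₀ (by positivity) ?_
  have := h x hx
  rw [add_div, div_self (by positivity), add_comm, ← mul_div_assoc]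
  gcongr

/-- Passing from local bounds to compact sets. -/
theorem exists_lintegral_le_of_locally {G : ℝ → ℝ → ℝ} {e : ℝ → ℝ} (he : ∀ δ, 0 < δ → 0 ≤ e δ)
    {s : Set ℝ} (hs : IsCompact s)
    (h : ∀ x₀ ∈ s, ∃ t ∈ 𝓝 x₀, ∃ C : ℝ, 0 ≤ C ∧ ∀ δ : ℝ, 0 < δ →
      ∫⁻ x in t, ENNReal.ofReal (G δ x) ≤ ENNReal.ofReal (C * e δ)) :
    ∃ C : ℝ, 0 ≤ C ∧ ∀ δ : ℝ, 0 < δ →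
      ∫⁻ x in s, ENNReal.ofReal (G δ x) ≤ ENNReal.ofReal (C * e δ) := by
  refine hs.induction_on (p := fun s => ∃ C : ℝ, 0 ≤ C ∧ ∀ δ : ℝ, 0 < δ →
      ∫⁻ x in s, ENNReal.ofReal (G δ x) ≤ ENNReal.ofReal (C * e δ)) ⟨0, le_rfl, by simp⟩ ?_ ?_ ?_
  · rintro s t hst ⟨C, hC, h⟩
    exact ⟨C, hC, fun δ hδ => (lintegral_mono_set hst).trans (h δ hδ)⟩
  · rintro s t ⟨C, hC, h⟩ ⟨D, hD, h'⟩
    refine ⟨C + D, by positivity, fun δ hδ => (lintegral_union_le _ _ _).trans ?_⟩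
    rw [add_mul, ENNReal.ofReal_add (mul_nonneg hC (he δ hδ)) (mul_nonneg hD (he δ hδ))]
    exact add_le_add (h δ hδ) (h' δ hδ)
  · intro x hx
    obtain ⟨t, ht, hC⟩ := h x hx
    exact ⟨t, mem_nhdsWithin_of_mem_nhds ht, hC⟩

end Integrals

section Periodic

theorem lintegral_Ioc_eq_of_periodic {T : ℝ} (hT : 0 < T) {G : ℝ → ENNReal}
    (hG : Function.Periodic G T) (s t : ℝ) :
    ∫⁻ x in Ioc s (s + T), G x = ∫⁻ x in Ioc t (t + T), G x := by
  refine (isAddFundamentalDomain_Ioc hT s).setLIntegral_eq (isAddFundamentalDomain_Ioc hT t) G ?_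
  rintro ⟨g, hg⟩ x
  obtain ⟨k, rfl⟩ := AddSubgroup.mem_zmultiples_iff.1 hg
  rw [AddSubgroup.mk_vadd, vadd_eq_add, add_comm]
  exact hG.zsmul k x

theorem summable_int_one_add_sq_inv : Summable fun k : ℤ => 3 * (1 + (k : ℝ) ^ 2)⁻¹ := by
  refine Summable.mul_left _ ?_
  have h := (Real.summable_one_div_int_pow (p := 2)).2 one_lt_two
  refine Summable.of_nonneg_of_le (fun k => by positivity) (fun k => ?_)
    (h.add (hasSum_pi_single (0 : ℤ) (1 : ℝ)).summable)
  · rcases eq_or_ne k 0 with rfl | hk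
    · simp
    · have : (0 : ℝ) < (k : ℝ) ^ 2 := by positivity
      rw [Pi.single_eq_of_ne hk, add_zero, one_div]
      exact inv_anti₀ this (by linarith)

/-- Quadratic decay is enough: it is only summed over periods. -/
theorem gaussianPDFReal_le_inv (x : ℝ) :
    ProbabilityTheory.gaussianPDFReal 0 1 x ≤ (1 + x ^ 2 / 2)⁻¹ := by
  rw [ProbabilityTheory.gaussianPDFReal_def]
  simp only [NNReal.coe_one, mul_one, sub_zero]
  have h₁ : (√(2 * Real.pi))⁻¹ ≤ 1 :=
    inv_le_one_of_one_le₀ (Real.one_le_sqrt.2 (by linarith [Real.pi_gt_three]))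
  have h₂ : Real.exp (-x ^ 2 / 2) ≤ (1 + x ^ 2 / 2)⁻¹ := by
    rw [neg_div, Real.exp_neg]
    exact inv_anti₀ (by positivity) (by linarith [Real.add_one_le_exp (x ^ 2 / 2)])
  calc _ ≤ 1 * Real.exp (-x ^ 2 / 2) := by gcongr
    _ ≤ _ := by rwa [one_mul]

theorem gaussianPDFReal_le_of_mem_Ioc {k : ℤ} {x : ℝ}
    (hx : x ∈ Ioc (k • (2 * Real.pi)) ((k + 1) • (2 * Real.pi))) :
    ProbabilityTheory.gaussianPDFReal 0 1 x ≤ 3 * (1 + (k : ℝ) ^ 2)⁻¹ := by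
  refine (gaussianPDFReal_le_inv x).trans ?_
  rw [← div_eq_mul_inv, inv_le_comm₀ (by positivity) (by positivity), inv_div,
    div_le_iff₀ (by norm_num)]
  obtain ⟨h₁, h₂⟩ := hx
  simp only [zsmul_eq_mul, Int.cast_add, Int.cast_one] at h₁ h₂
  have hpi := Real.pi_gt_three
  -- Squaring gives `k² ≤ x²/2 + 2`, so `1 + k² ≤ 3(1 + x²/2)`: the source of the 3.
  have hk : |(k : ℝ)| ≤ |x| / 2 + 1 := by
    rcases le_total 0 x with h0 | h0
    · rw [abs_of_nonneg h0, abs_le]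
      constructor <;> by_contra! hcon <;> nlinarith
    · rw [abs_of_nonpos h0, abs_le]
      constructor <;> by_contra! hcon <;> nlinarith
  have h4 : (k : ℝ) ^ 2 ≤ (|x| / 2 + 1) ^ 2 := by
    rw [← sq_abs (k : ℝ)]
    gcongr
  nlinarith [sq_abs x, sq_nonneg (|x| / 2 - 1)]

/-- The Gaussian integral of a periodic function is controlled by its integral over a period. -/
theorem exists_lintegral_mul_gaussianPDFReal_le :
    ∃ K : ℝ, 0 ≤ K ∧ ∀ G : ℝ → ENNReal, Function.Periodic G (2 * Real.pi) →
      ∫⁻ x, G x * ENNReal.ofReal (ProbabilityTheory.gaussianPDFReal 0 1 x)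
        ≤ ENNReal.ofReal K * ∫⁻ x in Icc 0 (2 * Real.pi), G x := by
  refine ⟨∑' k : ℤ, 3 * (1 + (k : ℝ) ^ 2)⁻¹, tsum_nonneg fun k => by positivity, fun G hG => ?_⟩
  have hT : 0 < 2 * Real.pi := by positivity
  rw [← setLIntegral_univ, ← iUnion_Ioc_zsmul hT]
  refine (lintegral_iUnion_le _ _).trans ?_
  rw [ENNReal.ofReal_tsum_of_nonneg (fun k => by positivity) summable_int_one_add_sq_inv,
    ← ENNReal.tsum_mul_right]
  refine ENNReal.tsum_le_tsum fun k => ?_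
  calc ∫⁻ x in Ioc (k • (2 * Real.pi)) ((k + 1) • (2 * Real.pi)),
        G x * ENNReal.ofReal (ProbabilityTheory.gaussianPDFReal 0 1 x)
      ≤ ∫⁻ x in Ioc (k • (2 * Real.pi)) ((k + 1) • (2 * Real.pi)),
        ENNReal.ofReal (3 * (1 + (k : ℝ) ^ 2)⁻¹) * G x := by
        refine setLIntegral_mono_ae' measurableSet_Ioc (Eventually.of_forall fun x hx => ?_)
        rw [mul_comm]
        gcongr
        exact gaussianPDFReal_le_of_mem_Ioc hx
    _ = ENNReal.ofReal (3 * (1 + (k : ℝ) ^ 2)⁻¹) *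
        ∫⁻ x in Ioc (k • (2 * Real.pi)) ((k + 1) • (2 * Real.pi)), G x :=
        lintegral_const_mul' _ _ ENNReal.ofReal_ne_top
    _ ≤ _ := by
        rw [add_smul, one_smul, lintegral_Ioc_eq_of_periodic hT hG _ 0, zero_add]
        gcongr
        exact Ioc_subset_Icc_self

end Periodic

end TrigGauss

/-! ### Gaussian density and integration by parts along a shift. -/

namespace TrigGauss

open MeasureTheory Filter Topology Set ProbabilityTheory

section GaussianDensity

theorem hasDerivAt_gaussianPDFReal (x : ℝ) :
    HasDerivAt (gaussianPDFReal 0 1) (-x * gaussianPDFReal 0 1 x) x := by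
  rw [gaussianPDFReal_def]
  simp only [NNReal.coe_one, mul_one, sub_zero]
  have h : HasDerivAt (fun y : ℝ => -y ^ 2 / 2) (-x) x := by
    refine (((hasDerivAt_pow 2 x).neg).div_const 2).congr_deriv ?_
    simp only [Nat.cast_ofNat, Nat.add_one_sub_one, pow_one]
    ring
  refine (h.exp.const_mul _).congr_deriv ?_
  ring

theorem continuous_gaussianPDFReal : Continuous (gaussianPDFReal 0 1) :=
  continuous_iff_continuousAt.2 fun x => (hasDerivAt_gaussianPDFReal x).continuousAt

theorem integral_gaussianReal_eq (g : ℝ → ℝ) :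
    ∫ x, g x ∂gaussianReal 0 1 = ∫ x, g x * gaussianPDFReal 0 1 x := by
  rw [integral_gaussianReal_eq_integral_smul one_ne_zero]
  simp only [smul_eq_mul, mul_comm]

theorem integrable_gaussianReal_iff_mul (g : ℝ → ℝ) :
    Integrable g (gaussianReal 0 1) ↔ Integrable fun x => g x * gaussianPDFReal 0 1 x := by
  rw [gaussianReal_of_var_ne_zero 0 one_ne_zero, integrable_withDensity_iff_integrable_smul'
    (measurable_gaussianPDF 0 1) (Eventually.of_forall fun _ => gaussianPDF_lt_top)]
  simp only [toReal_gaussianPDF, smul_eq_mul, mul_comm]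

theorem integrable_abs_gaussianReal : Integrable (fun x : ℝ => |x|) (gaussianReal 0 1) :=
  (memLp_one_iff_integrable.1 (by exact_mod_cast memLp_id_gaussianReal 1)).abs

/-- From `|x| ≤ (1 + x²)/2` and unit variance; the crude value 1 is enough because `1 ≤ √(π/2)`. -/
theorem integral_abs_gaussianReal_le_one : ∫ x, |x| ∂gaussianReal 0 1 ≤ 1 := by
  have hv : ∫ x, x ^ 2 ∂gaussianReal 0 1 = 1 := by
    have := variance_fun_id_gaussianReal (μ := 0) (v := 1)
    rw [variance_eq_integral (by fun_prop), integral_id_gaussianReal] at this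
    simpa using this
  have hi : Integrable (fun x : ℝ => x ^ 2) (gaussianReal 0 1) :=
    (memLp_id_gaussianReal (μ := 0) (v := 1) 2).integrable_sq
  calc ∫ x, |x| ∂gaussianReal 0 1 ≤ ∫ x, (1 + x ^ 2) / 2 ∂gaussianReal 0 1 := by
        refine integral_mono integrable_abs_gaussianReal
          (((integrable_const 1).add hi).div_const 2) fun x => ?_
        have := sq_nonneg (|x| - 1)
        have := sq_abs x
        simp only
        linarith
    _ = 1 := by
        rw [integral_div, integral_add (integrable_const 1) hi, hv]
        simp

end GaussianDensity

section ShiftEstimate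

variable {h : ℝ → ℝ}

/-- The increment of `h` has a primitive of size at most `|u|`; every factor `|u|` in the increment
bounds originates here. -/
theorem hasDerivAt_integral_shift (hc : Continuous h) (u y : ℝ) :
    HasDerivAt (fun y => ∫ s in y..y + u, h s) (h (y + u) - h y) y := by
  have hd : ∀ z, HasDerivAt (fun z => ∫ s in (0 : ℝ)..z, h s) (h z) z := fun z =>
    intervalIntegral.integral_hasDerivAt_right (hc.intervalIntegrable _ _)
      (hc.stronglyMeasurableAtFilter _ _) hc.continuousAt
  have := ((hd (y + u)).comp_add_const y u).sub (hd y)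
  refine this.congr_of_eventuallyEq (Eventually.of_forall fun z => ?_)
  exact (intervalIntegral.integral_interval_sub_left (hc.intervalIntegrable _ _)
    (hc.intervalIntegrable _ _)).symm

theorem abs_integral_shift_le (hb : ∀ x, |h x| ≤ 1) (u y : ℝ) :
    |∫ s in y..y + u, h s| ≤ |u| := by
  simpa using intervalIntegral.norm_integral_le_of_norm_le_const (a := y) (b := y + u) (f := h)
    (C := 1) fun x _ => hb x

/-- Integration by parts against the increment of a bounded function along `f`. -/
theorem abs_integral_shift_mul_deriv_le (hc : Continuous h) (hb : ∀ x, |h x| ≤ 1) (u : ℝ)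
    {f f' V V' : ℝ → ℝ} (hf : ∀ x, HasDerivAt f (f' x) x) (hV : ∀ x, HasDerivAt V (V' x) x)
    (hVi : Integrable V) (hVi' : Integrable V') (hfV : Integrable fun x => f' x * V x) :
    |∫ x, (h (f x + u) - h (f x)) * (f' x * V x)| ≤ |u| * ∫ x, |V' x| := by
  have hfc : Continuous f := continuous_iff_continuousAt.2 fun x => (hf x).continuousAt
  set H : ℝ → ℝ := fun y => ∫ s in y..y + u, h s with hH
  have hHc : Continuous H :=
    continuous_iff_continuousAt.2 fun x => (hasDerivAt_integral_shift hc u x).continuousAt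
  have hHb : ∀ x, ‖H (f x)‖ ≤ |u| := fun x => abs_integral_shift_le hb u (f x)
  have hHm : AEStronglyMeasurable (fun x => H (f x)) volume :=
    (hHc.comp hfc).aestronglyMeasurable
  have h2 : ∀ x, ‖h (f x + u) - h (f x)‖ ≤ 2 := fun x =>
    (norm_sub_le _ _).trans (by
      rw [Real.norm_eq_abs, Real.norm_eq_abs]; linarith [hb (f x + u), hb (f x)])
  have hhm : AEStronglyMeasurable (fun x => h (f x + u) - h (f x)) volume :=
    ((hc.comp (hfc.add continuous_const)).sub (hc.comp hfc)).aestronglyMeasurable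
  have hibp := integral_mul_deriv_eq_deriv_mul_of_integrable
    (u := fun x => H (f x)) (u' := fun x => (h (f x + u) - h (f x)) * f' x) (v := V) (v' := V')
    (fun x _ => (hasDerivAt_integral_shift hc u (f x)).comp x (hf x)) (fun x _ => hV x)
    (hVi'.bdd_mul hHm (Eventually.of_forall hHb))
    (by
      have := hfV.bdd_mul hhm (Eventually.of_forall h2)
      refine this.congr (Eventually.of_forall fun x => ?_)
      simp only [Pi.mul_apply]
      ring)
    (hVi.bdd_mul hHm (Eventually.of_forall hHb))
  have he : ∫ x, (h (f x + u) - h (f x)) * (f' x * V x) = -∫ x, H (f x) * V' x := by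
    rw [hibp, neg_neg]
    simp only [mul_assoc]
  rw [he, abs_neg, ← integral_const_mul]
  refine norm_integral_le_of_norm_le (f := fun x => H (f x) * V' x) (hVi'.abs.const_mul _)
    (Eventually.of_forall fun x => ?_)
  rw [norm_mul]
  exact mul_le_mul_of_nonneg_right (hHb x) (norm_nonneg _)

/-- The case `f = id`, with the density as weight: the derivative of the density has `L¹` norm
`E|X|`. -/
theorem integral_gaussian_shift_le (hc : Continuous h) (hb : ∀ x, |h x| ≤ 1) (u : ℝ) :
    ∫ t, (h (t + u) - h t) ∂gaussianReal 0 1 ≤ |u| := by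
  have hV' : Integrable fun x : ℝ => |x| * gaussianPDFReal 0 1 x :=
    (integrable_gaussianReal_iff_mul _).1 integrable_abs_gaussianReal
  have hV'' : Integrable fun x : ℝ => -x * gaussianPDFReal 0 1 x :=
    hV'.mono' (by have := continuous_gaussianPDFReal; fun_prop) (Eventually.of_forall fun x => by
      rw [norm_mul, norm_neg, Real.norm_eq_abs, Real.norm_of_nonneg (gaussianPDFReal_nonneg _ _ _)])
  have key := abs_integral_shift_mul_deriv_le hc hb u (f := id) (f' := fun _ => 1)
    (fun x => hasDerivAt_id x) hasDerivAt_gaussianPDFReal (integrable_gaussianPDFReal 0 1)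
    hV'' (by simpa using integrable_gaussianPDFReal 0 1)
  simp only [id, one_mul] at key
  rw [integral_gaussianReal_eq]
  refine (le_abs_self _).trans (key.trans (mul_le_of_le_one_right (abs_nonneg u) ?_))
  refine le_trans (le_of_eq ?_) integral_abs_gaussianReal_le_one
  rw [integral_gaussianReal_eq]
  congr 1 with x
  rw [abs_mul, abs_neg, abs_of_nonneg (gaussianPDFReal_nonneg _ _ _)]

end ShiftEstimate

end TrigGauss

/-! ### Regularized division by `f'`, and the shift exponent `1/(2n)`. -/

namespace TrigGauss

open MeasureTheory Filter Topology Set ProbabilityTheory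

section RegularizedQuotient

variable {F F' : ℝ → ℝ} {δ : ℝ}

/-- `F / (F² + δ²)` times the Gaussian density. -/
noncomputable def regWeight (F : ℝ → ℝ) (δ x : ℝ) : ℝ :=
  F x / (F x ^ 2 + δ ^ 2) * gaussianPDFReal 0 1 x

/-- The derivative of `regWeight`, where `F'` is the derivative of `F`. -/
noncomputable def regWeightDeriv (F F' : ℝ → ℝ) (δ x : ℝ) : ℝ :=
  F' x * (δ ^ 2 - F x ^ 2) / (F x ^ 2 + δ ^ 2) ^ 2 * gaussianPDFReal 0 1 x
    + F x / (F x ^ 2 + δ ^ 2) * (-x * gaussianPDFReal 0 1 x)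

theorem hasDerivAt_regWeight (hF : ∀ x, HasDerivAt F (F' x) x) (hδ : 0 < δ) (x : ℝ) :
    HasDerivAt (regWeight F δ) (regWeightDeriv F F' δ x) x := by
  have hpos : F x ^ 2 + δ ^ 2 ≠ 0 := by positivity
  refine (((hF x).fun_div (((hF x).fun_pow 2).add_const (δ ^ 2)) hpos).fun_mul
    (hasDerivAt_gaussianPDFReal x)).congr_deriv ?_
  rw [regWeightDeriv]
  congr 3
  push_cast
  ring

theorem abs_div_sq_add_sq_le (hδ : 0 < δ) (y : ℝ) : |y / (y ^ 2 + δ ^ 2)| ≤ 1 / (2 * δ) := by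
  rw [abs_div, abs_of_pos (show 0 < y ^ 2 + δ ^ 2 by positivity),
    div_le_div_iff₀ (by positivity) (by positivity)]
  nlinarith [sq_nonneg (|y| - δ), sq_abs y]

theorem abs_regWeightDeriv_le (hδ : 0 < δ) (x : ℝ) :
    |regWeightDeriv F F' δ x|
      ≤ |F' x| / (F x ^ 2 + δ ^ 2) * gaussianPDFReal 0 1 x
        + 1 / (2 * δ) * (|x| * gaussianPDFReal 0 1 x) := by
  have hφ := gaussianPDFReal_nonneg 0 1 x
  have hpos : 0 < F x ^ 2 + δ ^ 2 := by positivity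
  refine (abs_add_le _ _).trans (add_le_add ?_ ?_)
  · rw [abs_mul, abs_of_nonneg hφ, abs_div, abs_mul, abs_of_pos (pow_pos hpos 2)]
    refine mul_le_mul_of_nonneg_right ?_ hφ
    rw [div_le_div_iff₀ (by positivity) hpos, sq (F x ^ 2 + δ ^ 2), ← mul_assoc]
    have : |δ ^ 2 - F x ^ 2| ≤ F x ^ 2 + δ ^ 2 :=
      abs_le.2 ⟨by nlinarith [sq_nonneg δ], by nlinarith [sq_nonneg (F x)]⟩
    gcongr
  · rw [abs_mul, abs_mul, abs_neg, abs_of_nonneg hφ]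
    gcongr
    exact abs_div_sq_add_sq_le hδ _

theorem integrable_bounded_mul_gaussianPDFReal {g : ℝ → ℝ} (hg : Continuous g) {B : ℝ}
    (hB : ∀ x, |g x| ≤ B) : Integrable fun x => g x * gaussianPDFReal 0 1 x :=
  (integrable_gaussianPDFReal 0 1).bdd_mul hg.aestronglyMeasurable (Eventually.of_forall hB)

/-- The increment estimate for `f` with derivative `F`, in terms of the two singular integrals. -/
theorem integral_increment_gaussian_le {f : ℝ → ℝ} (hf : ∀ x, HasDerivAt f (F x) x)
    (hF : ∀ x, HasDerivAt F (F' x) x) (hF'c : Continuous F') {B : ℝ} (hB : ∀ x, |F' x| ≤ B)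
    (hδ : 0 < δ) {h : ℝ → ℝ} (hc : Continuous h) (hb : ∀ x, |h x| ≤ 1) (u : ℝ) :
    |∫ x, (h (f x + u) - h (f x)) ∂gaussianReal 0 1|
      ≤ |u| * ((∫ x, |F' x| / (F x ^ 2 + δ ^ 2) * gaussianPDFReal 0 1 x) + 1 / (2 * δ))
        + 2 * ∫ x, δ ^ 2 / (F x ^ 2 + δ ^ 2) * gaussianPDFReal 0 1 x := by
  have hfc : Continuous f := continuous_iff_continuousAt.2 fun x => (hf x).continuousAt
  have hFc : Continuous F := continuous_iff_continuousAt.2 fun x => (hF x).continuousAt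
  have hφc := continuous_gaussianPDFReal
  have hpos : ∀ x, F x ^ 2 + δ ^ 2 ≠ 0 := fun x => by positivity
  have hpos' : ∀ x, 0 < F x ^ 2 + δ ^ 2 := fun x => by positivity
  have hB0 : 0 ≤ B := (abs_nonneg _).trans (hB 0)
  have hi1 : Integrable fun x => |F' x| / (F x ^ 2 + δ ^ 2) * gaussianPDFReal 0 1 x := by
    refine integrable_bounded_mul_gaussianPDFReal (B := B / δ ^ 2)
      (hF'c.abs.div (by fun_prop) hpos) fun x => ?_
    rw [abs_div, abs_abs, abs_of_pos (hpos' x)]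
    have := hB x
    have : δ ^ 2 ≤ F x ^ 2 + δ ^ 2 := le_add_of_nonneg_left (sq_nonneg _)
    gcongr
  have hi2 : Integrable fun x => δ ^ 2 / (F x ^ 2 + δ ^ 2) * gaussianPDFReal 0 1 x := by
    refine integrable_bounded_mul_gaussianPDFReal (B := 1)
      (continuous_const.div (by fun_prop) hpos) fun x => ?_
    rw [abs_of_nonneg (by positivity)]
    exact div_le_one_of_le₀ (le_add_of_nonneg_left (sq_nonneg _)) (hpos' x).le
  have hi3 : Integrable fun x : ℝ => |x| * gaussianPDFReal 0 1 x :=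
    (integrable_gaussianReal_iff_mul _).1 integrable_abs_gaussianReal
  have hV : Integrable (regWeight F δ) :=
    integrable_bounded_mul_gaussianPDFReal (hFc.div (by fun_prop) hpos)
      fun x => abs_div_sq_add_sq_le hδ (F x)
  have hdom : Integrable fun x => |F' x| / (F x ^ 2 + δ ^ 2) * gaussianPDFReal 0 1 x
      + 1 / (2 * δ) * (|x| * gaussianPDFReal 0 1 x) := hi1.add (hi3.const_mul _)
  have hV'c : Continuous (regWeightDeriv F F' δ) :=
    (((hF'c.mul (by fun_prop)).div (by fun_prop) fun x => pow_ne_zero 2 (hpos x)).mul hφc).add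
      ((hFc.div (by fun_prop) hpos).mul (by fun_prop))
  have hV' : Integrable (regWeightDeriv F F' δ) :=
    hdom.mono' hV'c.aestronglyMeasurable (Eventually.of_forall fun x => abs_regWeightDeriv_le hδ x)
  have hFV : Integrable fun x => F x * regWeight F δ x := by
    have hcont : Continuous fun x => F x * (F x / (F x ^ 2 + δ ^ 2)) :=
      hFc.mul (hFc.div (by fun_prop) hpos)
    refine (integrable_bounded_mul_gaussianPDFReal (B := 1) hcont fun x => ?_).congr
      (Eventually.of_forall fun x => ?_)
    · rw [← mul_div_assoc, ← sq, abs_of_nonneg (by positivity)]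
      exact div_le_one_of_le₀ (le_add_of_nonneg_right (sq_nonneg _)) (hpos' x).le
    · simp only [regWeight]
      ring
  have h2 : ∀ x, ‖h (f x + u) - h (f x)‖ ≤ 2 := fun x =>
    (norm_sub_le _ _).trans (by
      rw [Real.norm_eq_abs, Real.norm_eq_abs]; linarith [hb (f x + u), hb (f x)])
  have hhm : AEStronglyMeasurable (fun x => h (f x + u) - h (f x)) volume :=
    ((hc.comp (hfc.add continuous_const)).sub (hc.comp hfc)).aestronglyMeasurable
  -- Splits `1 = F · F/(F²+δ²) + δ²/(F²+δ²)`: the first summand admits integration by parts, the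
  -- second is small off the zeros of `F`.
  have hsplit : ∫ x, (h (f x + u) - h (f x)) ∂gaussianReal 0 1
      = (∫ x, (h (f x + u) - h (f x)) * (F x * regWeight F δ x))
        + ∫ x, (h (f x + u) - h (f x)) *
          (δ ^ 2 / (F x ^ 2 + δ ^ 2) * gaussianPDFReal 0 1 x) := by
    rw [integral_gaussianReal_eq, ← integral_add (hFV.bdd_mul hhm (Eventually.of_forall h2))
      (hi2.bdd_mul hhm (Eventually.of_forall h2))]
    congr 1 with x
    rw [← mul_add]
    congr 1
    have := hpos x
    rw [regWeight]
    field_simp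
  have hfirst := abs_integral_shift_mul_deriv_le hc hb u hf (hasDerivAt_regWeight hF hδ) hV hV' hFV
  have hVint : ∫ x, |regWeightDeriv F F' δ x|
      ≤ (∫ x, |F' x| / (F x ^ 2 + δ ^ 2) * gaussianPDFReal 0 1 x) + 1 / (2 * δ) := by
    refine (integral_mono hV'.abs hdom fun x => abs_regWeightDeriv_le hδ x).trans ?_
    rw [integral_add hi1 (hi3.const_mul _), integral_const_mul,
      ← integral_gaussianReal_eq fun x => |x|]
    have := mul_le_of_le_one_right (show 0 ≤ 1 / (2 * δ) by positivity)
      integral_abs_gaussianReal_le_one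
    linarith
  have hsecond : |∫ x, (h (f x + u) - h (f x)) *
      (δ ^ 2 / (F x ^ 2 + δ ^ 2) * gaussianPDFReal 0 1 x)|
      ≤ 2 * ∫ x, δ ^ 2 / (F x ^ 2 + δ ^ 2) * gaussianPDFReal 0 1 x := by
    rw [← integral_const_mul]
    refine norm_integral_le_of_norm_le (f := fun x => (h (f x + u) - h (f x)) *
      (δ ^ 2 / (F x ^ 2 + δ ^ 2) * gaussianPDFReal 0 1 x)) (hi2.const_mul 2)
      (Eventually.of_forall fun x => ?_)
    have hnn : 0 ≤ δ ^ 2 / (F x ^ 2 + δ ^ 2) * gaussianPDFReal 0 1 x :=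
      mul_nonneg (by positivity) (gaussianPDFReal_nonneg _ _ _)
    rw [norm_mul, Real.norm_of_nonneg hnn]
    exact mul_le_mul_of_nonneg_right (h2 x) hnn
  rw [hsplit]
  refine (abs_add_le _ _).trans (add_le_add (hfirst.trans ?_) hsecond)
  exact mul_le_mul_of_nonneg_left hVint (abs_nonneg u)

end RegularizedQuotient

section PeriodicWeight

/-- Gaussian integrals of a family of continuous periodic functions which is locally controlled. -/
theorem exists_integral_mul_gaussianPDFReal_le {G : ℝ → ℝ → ℝ} {e : ℝ → ℝ}
    (he : ∀ δ, 0 < δ → 0 ≤ e δ) (hG : ∀ δ, 0 < δ → Continuous (G δ))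
    (hG0 : ∀ δ x, 0 ≤ G δ x) (hGp : ∀ δ, Function.Periodic (G δ) (2 * Real.pi))
    (h : ∀ x₀, ∃ t ∈ 𝓝 x₀, ∃ C : ℝ, 0 ≤ C ∧ ∀ δ : ℝ, 0 < δ →
      ∫⁻ x in t, ENNReal.ofReal (G δ x) ≤ ENNReal.ofReal (C * e δ)) :
    ∃ C : ℝ, 0 ≤ C ∧ ∀ δ : ℝ, 0 < δ → ∫ x, G δ x * gaussianPDFReal 0 1 x ≤ C * e δ := by
  obtain ⟨C, hC, hCl⟩ := exists_lintegral_le_of_locally he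
    (isCompact_Icc (a := (0 : ℝ)) (b := 2 * Real.pi)) fun x _ => h x
  obtain ⟨K, hK, hKl⟩ := exists_lintegral_mul_gaussianPDFReal_le
  refine ⟨K * C, by positivity, fun δ hδ => ?_⟩
  have hnn : ∀ x, 0 ≤ G δ x * gaussianPDFReal 0 1 x := fun x =>
    mul_nonneg (hG0 δ x) (gaussianPDFReal_nonneg _ _ _)
  rw [integral_eq_lintegral_of_nonneg_ae (Eventually.of_forall hnn)
    ((hG δ hδ).mul continuous_gaussianPDFReal).aestronglyMeasurable]
  refine ENNReal.toReal_le_of_le_ofReal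
    (mul_nonneg (mul_nonneg hK hC) (he δ hδ)) ?_
  simp only [ENNReal.ofReal_mul (hG0 δ _)]
  refine (hKl (fun x => ENNReal.ofReal (G δ x)) fun x => by simp only [hGp δ x]).trans ?_
  rw [mul_assoc, ENNReal.ofReal_mul hK]
  gcongr
  exact hCl δ hδ

end PeriodicWeight

section TrigShift

theorem analyticAt_trigPoly (n : ℕ) (a b : ℕ → ℝ) (x : ℝ) : AnalyticAt ℝ (trigPoly n a b) x := by
  unfold trigPoly
  fun_prop

theorem continuous_trigPoly (n : ℕ) (a b : ℕ → ℝ) : Continuous (trigPoly n a b) :=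
  continuous_iff_continuousAt.2 fun x => (hasDerivAt_trigPoly n a b x).continuousAt

/-- A zero of `f'` of order `2n` would make the derivatives of `f` of orders `1, …, 2n` vanish. -/
theorem analyticOrderAt_deriv_trigPoly_le {n : ℕ} (hn : 1 ≤ n) {a b : ℕ → ℝ}
    (hf : NonConst (trigPoly n a b)) (x : ℝ) :
    analyticOrderAt (deriv (trigPoly n a b)) x ≤ (2 * n - 1 : ℕ) := by
  by_contra! hlt
  have hle : ((2 * n : ℕ) : ℕ∞) ≤ analyticOrderAt (deriv (trigPoly n a b)) x := by
    have := Order.add_one_le_of_lt hlt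
    rwa [← Nat.cast_add_one, Nat.sub_add_cancel (by omega)] at this
  rw [natCast_le_analyticOrderAt_iff_iteratedDeriv_eq_zero
    (analyticAt_trigPoly n a b x).deriv] at hle
  have := le_of_iteratedDeriv_trigPoly_eq_zero hn hf x (2 * n) fun l hl => by
    rw [Finset.mem_Icc] at hl
    obtain ⟨i, rfl⟩ : ∃ i, l = i + 1 := ⟨l - 1, by omega⟩
    rw [iteratedDeriv_succ']
    exact hle i (by omega)
  omega

theorem exists_integral_increment_trigPoly_le {n : ℕ} (hn : 1 ≤ n) {a b : ℕ → ℝ}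
    (hf : NonConst (trigPoly n a b)) :
    ∃ C : ℝ, ∀ (h : ℝ → ℝ), Continuous h → (∀ x, |h x| ≤ 1) → ∀ u : ℝ,
      |∫ x, (h (trigPoly n a b x + u) - h (trigPoly n a b x)) ∂gaussianReal 0 1|
        ≤ C * |u| ^ (1 / (2 * (n : ℝ))) := by
  set F := trigPoly n (fun k => k * b k) (fun k => -(k * a k)) with hFdef
  set F' := trigPoly n (fun k => k * -(k * a k)) (fun k => -(k * (k * b k))) with hF'def
  have hfd : ∀ x, HasDerivAt (trigPoly n a b) (F x) x := hasDerivAt_trigPoly n a b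
  have hFd : ∀ x, HasDerivAt F (F' x) x := hasDerivAt_trigPoly n _ _
  have hFc : Continuous F := continuous_trigPoly _ _ _
  have hF'c : Continuous F' := continuous_trigPoly _ _ _
  have hFp : Function.Periodic F (2 * Real.pi) := trigPoly_add_two_pi _ _ _
  have hF'p : Function.Periodic F' (2 * Real.pi) := trigPoly_add_two_pi _ _ _
  have hN : 1 ≤ 2 * n - 1 := by omega
  obtain ⟨C₁, hC₁, h₁⟩ := exists_integral_mul_gaussianPDFReal_le
    (G := fun δ x => |F' x| / (F x ^ 2 + δ ^ 2)) (e := fun δ => 1 / δ)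
    (fun δ hδ => by positivity)
    (fun δ hδ => hF'c.abs.div (by fun_prop) fun x => by positivity)
    (fun δ x => by positivity)
    (fun δ x => by simp only [hFp x, hF'p x])
    (fun x₀ => by
      obtain ⟨t, ht, h⟩ := exists_nhds_lintegral_deriv_div_le hFd
        (hasDerivAt_trigPoly n _ _) (analyticAt_trigPoly n _ _ x₀)
      exact ⟨t, ht, 2 * Real.pi, by positivity, h⟩)
  obtain ⟨C₂, hC₂, h₂⟩ := exists_integral_mul_gaussianPDFReal_le
    (G := fun δ x => δ ^ 2 / (F x ^ 2 + δ ^ 2))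
    (e := fun δ => δ ^ (1 / ((2 * n - 1 : ℕ) : ℝ)))
    (fun δ hδ => by positivity)
    (fun δ hδ => continuous_const.div (by fun_prop) fun x => by positivity)
    (fun δ x => by positivity)
    (fun δ x => by simp only [hFp x])
    (fun x₀ => exists_nhds_lintegral_sq_div_le hN (analyticAt_trigPoly n _ _ x₀) (by
      have := analyticOrderAt_deriv_trigPoly_le hn hf x₀
      rwa [deriv_trigPoly] at this))
  refine ⟨C₁ + 1 / 2 + 2 * C₂, fun h hc hb u => ?_⟩
  have hn0 : (0 : ℝ) < n := by exact_mod_cast hn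
  rcases eq_or_ne u 0 with rfl | hu
  · simp only [add_zero, sub_self, integral_zero, abs_zero]
    rw [Real.zero_rpow (by positivity), mul_zero]
  have hu0 : 0 < |u| := abs_pos.2 hu
  have hN0 : (0 : ℝ) < ((2 * n - 1 : ℕ) : ℝ) := by exact_mod_cast hN
  have hNc : ((2 * n - 1 : ℕ) : ℝ) = 2 * n - 1 := by
    rw [Nat.cast_sub (by omega)]
    push_cast
    ring
  -- Chosen so that `|u|/δ` and `δ^(1/(2n-1))` both equal `|u|^(1/(2n))`.
  set δ := |u| ^ (((2 * n - 1 : ℕ) : ℝ) / (2 * n)) with hδdef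
  have hδ : 0 < δ := Real.rpow_pos_of_pos hu0 _
  have hδ₁ : |u| / δ = |u| ^ (1 / (2 * (n : ℝ))) := by
    rw [hδdef]
    nth_rewrite 1 [← Real.rpow_one |u|]
    rw [← Real.rpow_sub hu0, hNc]
    congr 1
    field_simp
    ring
  have hδ₂ : δ ^ (1 / ((2 * n - 1 : ℕ) : ℝ)) = |u| ^ (1 / (2 * (n : ℝ))) := by
    rw [hδdef, ← Real.rpow_mul hu0.le]
    congr 1
    field_simp
  refine (integral_increment_gaussian_le hfd hFd hF'c (abs_trigPoly_le _ _ _) hδ hc hb u).trans ?_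
  have k₁ := h₁ δ hδ
  have k₂ := h₂ δ hδ
  rw [hδ₂] at k₂
  calc _ ≤ |u| * (C₁ * (1 / δ) + 1 / (2 * δ)) + 2 * (C₂ * |u| ^ (1 / (2 * (n : ℝ)))) := by gcongr
    _ = (C₁ + 1 / 2) * (|u| / δ) + 2 * (C₂ * |u| ^ (1 / (2 * (n : ℝ)))) := by
      field_simp
    _ = _ := by rw [hδ₁]; ring

end TrigShift

end TrigGauss

/-! ### Comparison of two laws by Gaussian smoothing. -/

namespace TrigGauss

open MeasureTheory Filter Topology Set ProbabilityTheory

section Laws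

variable {Ω : Type*} [MeasurableSpace Ω] {μ : Measure Ω} {X : Ω → ℝ}

theorem integral_map_comp (hX : HasLaw X (gaussianReal 0 1) μ) {f h : ℝ → ℝ}
    (hf : Continuous f) (hh : Continuous h) :
    ∫ y, h y ∂(μ.map fun ω => f (X ω)) = ∫ x, h (f x) ∂gaussianReal 0 1 := by
  have hm : AEMeasurable (fun ω => f (X ω)) μ := hf.measurable.comp_aemeasurable hX.aemeasurable
  rw [integral_map hm hh.aestronglyMeasurable]
  exact hX.integral_comp (f := fun x => h (f x)) (hh.comp hf).aestronglyMeasurable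

theorem integrable_comp_gaussianReal {f h : ℝ → ℝ} (hf : Continuous f) (hc : Continuous h)
    (hb : ∀ x, |h x| ≤ 1) : Integrable (fun x => h (f x)) (gaussianReal 0 1) :=
  Integrable.of_bound (hc.comp hf).aestronglyMeasurable 1 (Eventually.of_forall fun x => hb (f x))

variable [IsProbabilityMeasure μ]

theorem varDist_map_le (hX : HasLaw X (gaussianReal 0 1) μ) {f g : ℝ → ℝ}
    (hf : Continuous f) (hg : Continuous g) {C : ℝ}
    (hC : ∀ h : ℝ → ℝ, Continuous h → (∀ x, |h x| ≤ 1) →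
      ∫ x, (h (f x) - h (g x)) ∂gaussianReal 0 1 ≤ C) :
    varDist (μ.map fun ω => f (X ω)) (μ.map fun ω => g (X ω)) ≤ C := by
  refine varDist_le_of_continuous _ _ fun h hc hb => ?_
  rw [integral_map_comp hX hf hc, integral_map_comp hX hg hc,
    ← integral_sub (integrable_comp_gaussianReal hf hc hb) (integrable_comp_gaussianReal hg hc hb)]
  exact hC h hc hb

theorem abs_integral_increment_le_of_shiftBound (hX : HasLaw X (gaussianReal 0 1) μ) {f : ℝ → ℝ}
    (hf : Continuous f) {α C : ℝ} (hS : ShiftBound μ (fun ω => f (X ω)) α C)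
    {h : ℝ → ℝ} (hc : Continuous h) (hb : ∀ x, |h x| ≤ 1) (u : ℝ) :
    |∫ x, (h (f x) - h (f x + u)) ∂gaussianReal 0 1| ≤ C * |u| ^ α := by
  have key : ∀ k : ℝ → ℝ, Continuous k → (∀ x, |k x| ≤ 1) →
      ∫ x, (k (f x) - k (f x + u)) ∂gaussianReal 0 1 ≤ C * |u| ^ α := by
    intro k hkc hkb
    have hfu : Continuous fun x => f x + u := hf.add continuous_const
    have := (integral_sub_integral_le_varDist (μ.map fun ω => f (X ω))
      (μ.map fun ω => f (X ω) + u) hkc.measurable hkb).trans (hS u)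
    rwa [integral_map_comp hX hf hkc, integral_map_comp hX hfu hkc,
      ← integral_sub (integrable_comp_gaussianReal hf hkc hkb)
        (integrable_comp_gaussianReal hfu hkc hkb)] at this
  refine abs_le.2 ⟨?_, key h hc hb⟩
  -- Testing against `-h` supplies the lower bound.
  have := key (fun x => -h x) hc.neg fun x => by simpa using hb x
  have e : ∫ x, (-h (f x) - -h (f x + u)) ∂gaussianReal 0 1
      = -∫ x, (h (f x) - h (f x + u)) ∂gaussianReal 0 1 := by
    rw [← integral_neg]
    congr 1 with x
    ring
  rw [e] at this
  linarith

theorem shiftBound_const_nonneg {Y : Ω → ℝ} {α C : ℝ} (hS : ShiftBound μ Y α C) : 0 ≤ C := by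
  have := (varDist_nonneg _ _).trans (hS 1)
  simpa using this

theorem exists_shiftBound_trigPoly (hX : HasLaw X (gaussianReal 0 1) μ) {n : ℕ} (hn : 1 ≤ n)
    {a b : ℕ → ℝ} (hf : NonConst (trigPoly n a b)) :
    ∃ C : ℝ, ShiftBound μ (fun ω => trigPoly n a b (X ω)) (1 / (2 * (n : ℝ))) C := by
  obtain ⟨C, hC⟩ := exists_integral_increment_trigPoly_le hn hf
  have hfc := continuous_trigPoly n a b
  refine ⟨C, fun u => varDist_map_le hX hfc (g := fun x => trigPoly n a b x + u)
    (hfc.add continuous_const) fun h hc hb => ?_⟩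
  have := hC (fun x => -h x) hc.neg (fun x => by simpa using hb x) u
  refine le_trans (le_of_eq ?_) ((le_abs_self _).trans this)
  congr 1 with x
  ring

end Laws

section Smoothing

theorem integrable_abs_rpow_gaussianReal {α : ℝ} (h0 : 0 ≤ α) (h1 : α ≤ 1) :
    Integrable (fun t : ℝ => |t| ^ α) (gaussianReal 0 1) := by
  refine ((integrable_const (1 : ℝ)).add integrable_abs_gaussianReal).mono'
    (continuous_abs.rpow_const fun _ => Or.inr h0).aestronglyMeasurable
    (Eventually.of_forall fun t => ?_)
  have ht := abs_nonneg t
  rw [Real.norm_of_nonneg (Real.rpow_nonneg ht _), Pi.add_apply]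
  rcases le_total |t| 1 with h | h
  · linarith [Real.rpow_le_one ht h h0]
  · have := Real.rpow_le_rpow_of_exponent_le h h1
    rw [Real.rpow_one] at this
    linarith

variable {f g h : ℝ → ℝ}

theorem integrable_smoothing (hf : Continuous f) (hc : Continuous h) (hb : ∀ x, |h x| ≤ 1)
    (ε : ℝ) : Integrable (Function.uncurry fun t x => h (f x + ε * t))
      ((gaussianReal 0 1).prod (gaussianReal 0 1)) := by
  have : Continuous (Function.uncurry fun t x => h (f x + ε * t)) := by
    unfold Function.uncurry
    fun_prop
  exact Integrable.of_bound this.aestronglyMeasurable 1 (Eventually.of_forall fun _ => hb _)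

theorem integrable_integral_smoothing (hf : Continuous f) (hc : Continuous h)
    (hb : ∀ x, |h x| ≤ 1) (ε : ℝ) :
    Integrable (fun t => ∫ x, h (f x + ε * t) ∂gaussianReal 0 1) (gaussianReal 0 1) :=
  (integrable_smoothing hf hc hb ε).integral_prod_left

/-- The shift bound with `u = εt`, averaged over Gaussian `t`. -/
theorem abs_integral_sub_smoothing_le (hf : Continuous f) (hc : Continuous h)
    (hb : ∀ x, |h x| ≤ 1) {α C ε : ℝ} (h0 : 0 ≤ α) (h1 : α ≤ 1) (hε : 0 < ε)
    (hS : ∀ u : ℝ, |∫ x, (h (f x) - h (f x + u)) ∂gaussianReal 0 1| ≤ C * |u| ^ α) :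
    |(∫ x, h (f x) ∂gaussianReal 0 1)
        - ∫ t, ∫ x, h (f x + ε * t) ∂gaussianReal 0 1 ∂gaussianReal 0 1|
      ≤ C * ε ^ α * ∫ t, |t| ^ α ∂gaussianReal 0 1 := by
  have e : (∫ x, h (f x) ∂gaussianReal 0 1)
        - ∫ t, ∫ x, h (f x + ε * t) ∂gaussianReal 0 1 ∂gaussianReal 0 1
      = ∫ t, ∫ x, (h (f x) - h (f x + ε * t)) ∂gaussianReal 0 1 ∂gaussianReal 0 1 := by
    have : ∀ t : ℝ, ∫ x, (h (f x) - h (f x + ε * t)) ∂gaussianReal 0 1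
        = (∫ x, h (f x) ∂gaussianReal 0 1) - ∫ x, h (f x + ε * t) ∂gaussianReal 0 1 := fun t =>
      integral_sub (integrable_comp_gaussianReal hf hc hb)
        (integrable_comp_gaussianReal (f := fun x => f x + ε * t)
          (hf.add continuous_const) hc hb)
    simp only [this]
    rw [integral_sub (integrable_const _) (integrable_integral_smoothing hf hc hb ε)]
    simp
  rw [e, ← integral_const_mul]
  refine norm_integral_le_of_norm_le
    (f := fun t => ∫ x, (h (f x) - h (f x + ε * t)) ∂gaussianReal 0 1)
    ((integrable_abs_rpow_gaussianReal h0 h1).const_mul _)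
    (Eventually.of_forall fun t => (hS (ε * t)).trans (le_of_eq ?_))
  rw [abs_mul, abs_of_pos hε, Real.mul_rpow hε.le (abs_nonneg t), mul_assoc]

/-- In the noise variable, passing from `q` to `p` is a shift by `(p - q)/ε`. -/
theorem integral_gaussian_translate_le (hc : Continuous h) (hb : ∀ x, |h x| ≤ 1) {ε : ℝ}
    (hε : 0 < ε) (p q : ℝ) :
    ∫ t, (h (p + ε * t) - h (q + ε * t)) ∂gaussianReal 0 1 ≤ |p - q| / ε := by
  have := integral_gaussian_shift_le (h := fun t => h (q + ε * t)) (by fun_prop)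
    (fun t => hb _) ((p - q) / ε)
  rw [abs_div, abs_of_pos hε] at this
  refine le_trans (le_of_eq ?_) this
  congr 1 with t
  have : q + ε * (t + (p - q) / ε) = p + ε * t := by
    field_simp
    ring
  rw [this]

/-- Fubini allows integrating over the noise first, with `x` fixed, where the translation bound
applies pointwise. -/
theorem smoothing_sub_smoothing_le (hf : Continuous f) (hg : Continuous g) (hc : Continuous h)
    (hb : ∀ x, |h x| ≤ 1) {ε D : ℝ} (hε : 0 < ε) (hD : ∀ x, |f x - g x| ≤ D) :
    (∫ t, ∫ x, h (f x + ε * t) ∂gaussianReal 0 1 ∂gaussianReal 0 1)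
      - ∫ t, ∫ x, h (g x + ε * t) ∂gaussianReal 0 1 ∂gaussianReal 0 1 ≤ D / ε := by
  have hF := integrable_smoothing hf hc hb ε
  have hG := integrable_smoothing hg hc hb ε
  have hF' : Integrable (fun x => ∫ t, h (f x + ε * t) ∂gaussianReal 0 1) (gaussianReal 0 1) :=
    hF.integral_prod_right
  have hG' : Integrable (fun x => ∫ t, h (g x + ε * t) ∂gaussianReal 0 1) (gaussianReal 0 1) :=
    hG.integral_prod_right
  rw [integral_integral_swap hF, integral_integral_swap hG, ← integral_sub hF' hG']
  have hle : ∀ x, (∫ t, h (f x + ε * t) ∂gaussianReal 0 1)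
      - ∫ t, h (g x + ε * t) ∂gaussianReal 0 1 ≤ D / ε := fun x => by
    rw [← integral_sub
      (integrable_comp_gaussianReal (f := fun t => f x + ε * t) (by fun_prop) hc hb)
      (integrable_comp_gaussianReal (f := fun t => g x + ε * t) (by fun_prop) hc hb)]
    refine (integral_gaussian_translate_le hc hb hε _ _).trans ?_
    have := hD x
    gcongr
  refine (integral_mono (hF'.sub hG') (integrable_const (D / ε)) hle).trans ?_
  simp

/-- The smoothing inequality, before optimizing in `ε`. -/
theorem integral_sub_le_of_increment_le (hf : Continuous f) (hg : Continuous g)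
    (hc : Continuous h) (hb : ∀ x, |h x| ≤ 1) {α Cf Cg ε D : ℝ} (h0 : 0 ≤ α) (h1 : α ≤ 1)
    (hε : 0 < ε) (hD : ∀ x, |f x - g x| ≤ D)
    (hSf : ∀ u : ℝ, |∫ x, (h (f x) - h (f x + u)) ∂gaussianReal 0 1| ≤ Cf * |u| ^ α)
    (hSg : ∀ u : ℝ, |∫ x, (h (g x) - h (g x + u)) ∂gaussianReal 0 1| ≤ Cg * |u| ^ α) :
    ∫ x, (h (f x) - h (g x)) ∂gaussianReal 0 1
      ≤ (Cf + Cg) * ε ^ α * (∫ t, |t| ^ α ∂gaussianReal 0 1) + D / ε := by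
  rw [integral_sub (integrable_comp_gaussianReal hf hc hb) (integrable_comp_gaussianReal hg hc hb)]
  have kf := (abs_le.1 (abs_integral_sub_smoothing_le hf hc hb h0 h1 hε hSf)).2
  have kg := (abs_le.1 (abs_integral_sub_smoothing_le hg hc hb h0 h1 hε hSg)).1
  have k := smoothing_sub_smoothing_le hf hg hc hb hε hD
  linarith

end Smoothing

section Optimization

/-- Optimizing `S ε^α M + D / ε` over `ε > 0`. -/
theorem le_of_forall_pos_le_rpow_add_div {v S M D α : ℝ} (hS : 0 ≤ S) (hM : 0 ≤ M) (hD : 0 ≤ D)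
    (hα : 0 < α) (h : ∀ ε, 0 < ε → v ≤ S * ε ^ α * M + D / ε) :
    v ≤ S ^ (1 / (α + 1)) * (M + 1) * D ^ (α / (α + 1)) := by
  have hα1 : 0 < α + 1 := by linarith
  rcases hS.eq_or_lt with rfl | hS
  -- If `S = 0` the infimum is approached as `ε → ∞`; `D + 1` keeps the chosen `ε` positive when `D
  -- = 0`.
  · rw [Real.zero_rpow (by positivity), zero_mul, zero_mul]
    refine le_of_forall_pos_le_add fun η hη => ?_
    have := h ((D + 1) / η) (by positivity)
    rw [zero_mul, zero_mul, zero_add, div_div_eq_mul_div] at this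
    refine this.trans ?_
    rw [zero_add, div_le_iff₀ (by positivity)]
    nlinarith
  rcases hD.eq_or_lt with rfl | hD
  -- If `D = 0` the infimum is approached as `ε → 0`.
  · rw [Real.zero_rpow (by positivity), mul_zero]
    refine le_of_forall_pos_le_add fun η hη => ?_
    have hε : 0 < (η / (S * (M + 1))) ^ (1 / α) := by positivity
    have := h _ hε
    rw [← Real.rpow_mul (by positivity), one_div_mul_cancel hα.ne', Real.rpow_one, zero_div,
      add_zero] at this
    refine this.trans ?_
    rw [zero_add, show S * (η / (S * (M + 1))) * M = η * (M / (M + 1)) by field_simp]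
    exact mul_le_of_le_one_right hη.le (div_le_one_of_le₀ (by linarith) (by linarith))
  -- This `ε` makes `S ε^α` and `D/ε` equal.
  have hε : 0 < (D / S) ^ (1 / (α + 1)) := by positivity
  refine (h _ hε).trans (le_of_eq ?_)
  have e₁ : S * ((D / S) ^ (1 / (α + 1))) ^ α = S ^ (1 / (α + 1)) * D ^ (α / (α + 1)) := by
    rw [← Real.rpow_mul (by positivity), Real.div_rpow hD.le hS.le,
      show 1 / (α + 1) * α = α / (α + 1) by ring, mul_div_assoc', mul_comm S, mul_div_assoc,
      mul_comm]
    congr 1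
    nth_rewrite 1 [← Real.rpow_one S]
    rw [← Real.rpow_sub hS]
    congr 1
    field_simp
    ring
  have e₂ : D / (D / S) ^ (1 / (α + 1)) = S ^ (1 / (α + 1)) * D ^ (α / (α + 1)) := by
    rw [Real.div_rpow hD.le hS.le, div_div_eq_mul_div, mul_comm D, mul_div_assoc]
    congr 1
    nth_rewrite 1 [← Real.rpow_one D]
    rw [← Real.rpow_sub hD]
    congr 1
    field_simp
    ring
  rw [e₁, e₂]
  ring

end Optimization

section Main

variable {Ω : Type*} [MeasurableSpace Ω] {μ : Measure Ω} [IsProbabilityMeasure μ] {X : Ω → ℝ}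

theorem abs_sub_le_supDist_trigPoly (n : ℕ) (a b c d : ℕ → ℝ) (x : ℝ) :
    |trigPoly n a b x - trigPoly n c d x| ≤ supDist (trigPoly n a b) (trigPoly n c d) := by
  refine le_ciSup (f := fun x => |trigPoly n a b x - trigPoly n c d x|)
    ⟨(∑ k ∈ Finset.range (n + 1), (|a k| + |b k|)) + ∑ k ∈ Finset.range (n + 1), (|c k| + |d k|),
      ?_⟩ x
  rintro _ ⟨y, rfl⟩
  exact (abs_sub _ _).trans (add_le_add (abs_trigPoly_le n a b y) (abs_trigPoly_le n c d y))

theorem varDist_trigPoly_le (hX : HasLaw X (gaussianReal 0 1) μ) {n : ℕ} (hn : 1 ≤ n)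
    {a b c d : ℕ → ℝ} {Cf Cg : ℝ}
    (hf : ShiftBound μ (fun ω => trigPoly n a b (X ω)) (1 / (2 * (n : ℝ))) Cf)
    (hg : ShiftBound μ (fun ω => trigPoly n c d (X ω)) (1 / (2 * (n : ℝ))) Cg) :
    varDist (μ.map fun ω => trigPoly n a b (X ω)) (μ.map fun ω => trigPoly n c d (X ω))
      ≤ boundConst (1 / (2 * (n : ℝ))) Cf Cg *
        supDist (trigPoly n a b) (trigPoly n c d) ^ (1 / (2 * (n : ℝ) + 1)) := by
  have hn1 : (1 : ℝ) ≤ n := by exact_mod_cast hn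
  have hα0 : (0 : ℝ) < 1 / (2 * (n : ℝ)) := by positivity
  have hα1 : 1 / (2 * (n : ℝ)) ≤ 1 := div_le_one_of_le₀ (by linarith) (by linarith)
  have hCf := shiftBound_const_nonneg hf
  have hCg := shiftBound_const_nonneg hg
  have hfc := continuous_trigPoly n a b
  have hgc := continuous_trigPoly n c d
  have hD := abs_sub_le_supDist_trigPoly n a b c d
  have hD0 := (abs_nonneg _).trans (hD 0)
  have hexp : 1 / (2 * (n : ℝ)) / (1 / (2 * (n : ℝ)) + 1) = 1 / (2 * (n : ℝ) + 1) := by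
    field_simp
    ring
  have hM : 0 ≤ ∫ t, |t| ^ (1 / (2 * (n : ℝ))) ∂gaussianReal 0 1 :=
    integral_nonneg fun t => by positivity
  have hv := le_of_forall_pos_le_rpow_add_div (add_nonneg hCf hCg) hM hD0 hα0 fun ε hε =>
    varDist_map_le hX hfc hgc fun h hc hb =>
      integral_sub_le_of_increment_le hfc hgc hc hb hα0.le hα1 hε hD
        (abs_integral_increment_le_of_shiftBound hX hfc hf hc hb)
        (abs_integral_increment_le_of_shiftBound hX hgc hg hc hb)
  rw [hexp] at hv
  refine hv.trans (mul_le_mul_of_nonneg_right ?_ (Real.rpow_nonneg hD0 _))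
  rw [boundConst]
  refine mul_le_mul_of_nonneg_left (add_le_add_right ?_ _)
    (Real.rpow_nonneg (add_nonneg hCf hCg) _)
  -- The argument yields `E|ν|^α + 1`; the stated constant is weaker because `π/2 ≥ 1`.
  exact Real.one_le_sqrt.2 (by linarith [Real.pi_gt_three])

end Main

end TrigGauss

theorem mainTheorem6 {Ω : Type*} [MeasurableSpace Ω] (μ : MeasureTheory.Measure Ω)
    [MeasureTheory.IsProbabilityMeasure μ] (X : Ω → ℝ)
    (hX : ProbabilityTheory.HasLaw X (ProbabilityTheory.gaussianReal 0 1) μ)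
    (n : ℕ) (hn : 1 ≤ n) :
    (∀ (m : ℕ) (a b : ℕ → ℝ),
      (∀ l ∈ Finset.Icc 1 (2 * m), iteratedDeriv l (TrigGauss.trigPoly n a b) 0 = 0) ↔
        (TrigGauss.derivSystem m n).mulVec
          (Sum.elim (fun k : Fin n => b (k + 1)) (fun k : Fin n => a (k + 1))) = 0) ∧
    (TrigGauss.derivSystem n n).det
      = (n.factorial : ℝ) ^ 3 * TrigGauss.vandermondeSq n ^ 2 ∧
    (TrigGauss.derivSystem n n).det ≠ 0 ∧
    (∀ a b : ℕ → ℝ, TrigGauss.NonConst (TrigGauss.trigPoly n a b) →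
      ∀ (x : ℝ) (m : ℕ),
        (∀ l ∈ Finset.Icc 1 m, iteratedDeriv l (TrigGauss.trigPoly n a b) x = 0) →
          m ≤ 2 * n - 1) ∧
    (∀ a b : ℕ → ℝ, TrigGauss.NonConst (TrigGauss.trigPoly n a b) →
      ∃ C : ℝ, TrigGauss.ShiftBound μ (fun ω => TrigGauss.trigPoly n a b (X ω))
        (1 / (2 * (n : ℝ))) C) ∧
    (∀ a b c d : ℕ → ℝ, TrigGauss.NonConst (TrigGauss.trigPoly n a b) →
      TrigGauss.NonConst (TrigGauss.trigPoly n c d) →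
      ∀ Cf Cg : ℝ,
        TrigGauss.ShiftBound μ (fun ω => TrigGauss.trigPoly n a b (X ω))
          (1 / (2 * (n : ℝ))) Cf →
        TrigGauss.ShiftBound μ (fun ω => TrigGauss.trigPoly n c d (X ω))
          (1 / (2 * (n : ℝ))) Cg →
        TrigGauss.varDist (μ.map fun ω => TrigGauss.trigPoly n a b (X ω))
            (μ.map fun ω => TrigGauss.trigPoly n c d (X ω))
          ≤ TrigGauss.boundConst (1 / (2 * (n : ℝ))) Cf Cg *
            TrigGauss.supDist (TrigGauss.trigPoly n a b) (TrigGauss.trigPoly n c d)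
              ^ (1 / (2 * (n : ℝ) + 1))) := by
  refine ⟨fun m a b => TrigGauss.iteratedDeriv_trigPoly_zero_iff m n a b,
    TrigGauss.det_derivSystem n, TrigGauss.det_derivSystem_ne_zero n,
    fun a b hf => TrigGauss.le_of_iteratedDeriv_trigPoly_eq_zero hn hf,
    fun a b hf => TrigGauss.exists_shiftBound_trigPoly hX hn hf,
    fun a b c d _ _ Cf Cg hCf hCg => TrigGauss.varDist_trigPoly_le hX hn hCf hCg⟩
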